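/- **Theorem (max-SLLN under physical dependence).** Let $(\Omega,\mathcal F,\mathbb P)$ be a probability space. For each $i\ge 1$ let $(\epsilon_{i,t})_{t\in\mathbb Z}$ be an i.i.d. sequence with values in a measurable space, and let $(\epsilon'_{i,t})_{t\in\mathbb Z}$ be an independent copy of it (the dependence between different coordinates $i$ is unrestricted). For $i,t\ge 1$ let $x_{i,t}=g_{i,t}(\epsilon_{i,t},\epsilon_{i,t-1},\dots)$ with $g_{i,t}$ measurable and real valued, and suppose that $x_{i,t}$ is integrable with $\mathbb E x_{i,t}=0$. Write $x'_{i,t}(m)$ for the variable obtained from $x_{i,t}$ by replacing $\epsilon_{i,t-m}$ with $\epsilon'_{i,t-m}$, and for $q>1$ put $$\theta^{(q)}_{i,t}(m)=\|x_{i,t}-x'_{i,t}(m)\|_q,\qquad m=0,1,2,\dots$$ Let $(k_n)$ be a non-decreasing sequence of nonnegative integers and $$\mathcal M_n=\max_{1\le i\le k_n}\Big|\frac1n\sum_{t=1}^n x_{i,t}\Big| .$$ Let $p>1$, $p'=\min(p,2)$, and suppose that $x_{i,t}$ is $\mathcal L_p$-physical dependent, i.e. $\sum_{m\ge0}\theta^{(p)}_{i,t}(m)<\infty$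 for all $i,t\ge1$, and that $\theta^{(p)}_{i,t}(m)\le d^{(p)}_{i,t}\psi_{i,m}$ for all $i,t\ge 1$, $m\ge 0$, with finite nonnegative constants $d^{(p)}_{i,t},\psi_{i,m}$, where for some $\lambda\ge1$, $\iota>0$ and $C<\infty$, $\psi_{i,m}\le C(m\vee1)^{-\lambda-\iota}$ for all $i\ge1$, $m\ge0$. (a) Let $b\in(1/p',1)$. Suppose that $$\sup_{n}\ \sum_{s=1}^\infty\max_{1\le i\le k_n}\{d^{(p)}_{i,s}/s^b\}^{p'}<\infty ,$$ or, alternatively, that this sum is finite for every $n$ and $d^{(p)}_{i,t}\le 2\|x_{i,t}\|_p$ for all $i,t\ge 1$. If $k_n\cdot\max_{1\le i\le k_n,1\le t\le n}\mathbb E|x_{i,t}|^p=o(n^{p(1-b)})$, that is, $k_n=o\big(n^{p(1-b)}/\max_{1\le i\le k_n,1\le t\le n}\mathbb E|x_{i,t}|^p\big)$, then $\mathcal M_n\to0$ almost surely. (b) Let $1<\alpha\le2$. Suppose that for all sufficiently large real $q$ there are also constants $d^{(q)}_{i,t}\ge 0$ with $\theta^{(q)}_{i,t}(m)\le d^{(q)}_{i,t}\psi_{i,m}$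 and $d^{(q)}_{i,t}\le2\|x_{i,t}\|_q$ for all $i,t\ge 1$, $m\ge 0$, and that $\sup_{i\ge 1}\mathring\gamma_i(\alpha)<\infty$, where $$\mathring\gamma_i(\alpha)=\limsup_{q\to\infty}q^{1/2-1/\alpha}\,\bar d^{(\alpha q)}\sum_{m=0}^\infty\psi_{i,m},\qquad \bar d^{(q)}=\limsup_{n\to\infty}\max_{1\le i\le k_n,1\le t\le n}\|x_{i,t}\|_q .$$ If $\ln k_n=o(n^{\alpha/2-\iota})$ for some $\iota>0$, then $\mathcal M_n\to0$ almost surely. -/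

import Mathlib

open MeasureTheory ProbabilityTheory Filter Topology Asymptotics
open scoped ENNReal NNReal

namespace MaxLLN

variable {Ω S : Type*} [MeasurableSpace Ω] [MeasurableSpace S]

/-- For every coordinate `i ≥ 1`, the innovations `(ε i t)`, `t ∈ ℤ`, are i.i.d. with values in the
measurable space `S`, and `(ε' i t)`, `t ∈ ℤ`, is an independent copy of the sequence `(ε i t)`.
Nothing is assumed about the dependence between different coordinates. -/
structure IsInnovation (μ : Measure Ω) (ε ε' : ℕ → ℤ → Ω → S) : Prop where
  measurable : ∀ i, 1 ≤ i → ∀ t, Measurable (ε i t)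
  measurable_copy : ∀ i, 1 ≤ i → ∀ t, Measurable (ε' i t)
  indep : ∀ i, 1 ≤ i → iIndepFun (fun t : ℤ => ε i t) μ
  identDistrib : ∀ i, 1 ≤ i → ∀ s t, IdentDistrib (ε i s) (ε i t) μ μ
  copy_indep : ∀ i, 1 ≤ i →
    IndepFun (fun ω => fun t : ℤ => ε i t ω) (fun ω => fun t : ℤ => ε' i t ω) μ
  copy_identDistrib : ∀ i, 1 ≤ i →
    IdentDistrib (fun ω => fun t : ℤ => ε i t ω) (fun ω => fun t : ℤ => ε' i t ω) μ μ

/-- `x_{i,t} = g_{i,t}(ε_{i,t}, ε_{i,t-1}, …)`. -/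
def proc (g : ℕ → ℕ → (ℕ → S) → ℝ) (ε : ℕ → ℤ → Ω → S) (i t : ℕ) (ω : Ω) : ℝ :=
  g i t (fun j : ℕ => ε i ((t : ℤ) - (j : ℤ)) ω)

/-- The coupled variable
`x'_{i,t}(m) = g_{i,t}(ε_{i,t}, …, ε_{i,t-m+1}, ε'_{i,t-m}, ε_{i,t-m-1}, …)`. -/
def coupled (g : ℕ → ℕ → (ℕ → S) → ℝ) (ε ε' : ℕ → ℤ → Ω → S) (i t m : ℕ) (ω : Ω) : ℝ :=
  g i t (fun j : ℕ =>
    if j = m then ε' i ((t : ℤ) - (j : ℤ)) ω else ε i ((t : ℤ) - (j : ℤ)) ω)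

/-- The serial physical dependence measure `θ_{i,t}^{(p)}(m) = ‖x_{i,t} - x'_{i,t}(m)‖_p`. -/
noncomputable def theta (μ : Measure Ω) (g : ℕ → ℕ → (ℕ → S) → ℝ) (ε ε' : ℕ → ℤ → Ω → S)
    (p : ℝ) (i t m : ℕ) : ℝ≥0∞ :=
  eLpNorm (fun ω => proc g ε i t ω - coupled g ε ε' i t m ω) (ENNReal.ofReal p) μ

/-- `L_p`-physical dependence: `Θ_{i,t}^{(p)} = ∑_{m ≥ 0} θ_{i,t}^{(p)}(m) < ∞`. -/
def IsPhysDep (μ : Measure Ω) (g : ℕ → ℕ → (ℕ → S) → ℝ) (ε ε' : ℕ → ℤ → Ω → S) (p : ℝ) : Prop :=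
  ∀ i t : ℕ, 1 ≤ i → 1 ≤ t → ∑' m : ℕ, theta μ g ε ε' p i t m < ∞

/-- `M_n = max_{1 ≤ i ≤ k_n} |(1/n) ∑_{t=1}^n x_{i,t}|`. -/
noncomputable def maxMean (x : ℕ → ℕ → Ω → ℝ) (k : ℕ → ℕ) (n : ℕ) (ω : Ω) : ℝ≥0 :=
  (Finset.Icc 1 (k n)).sup fun i => ‖(1 / (n : ℝ)) * ∑ t ∈ Finset.Icc 1 n, x i t ω‖₊

/-- `max_{1 ≤ i ≤ k_n, 1 ≤ t ≤ n} E|x_{i,t}|^p`. -/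
noncomputable def maxMoment (μ : Measure Ω) (x : ℕ → ℕ → Ω → ℝ) (k : ℕ → ℕ) (p : ℝ) (n : ℕ) :
    ℝ≥0∞ :=
  (Finset.Icc 1 (k n)).sup fun i => (Finset.Icc 1 n).sup fun t => ∫⁻ ω, ‖x i t ω‖ₑ ^ p ∂μ

/-- `∑_{s ≥ 1} max_{1 ≤ i ≤ k_n} (d_{i,s} / s^b)^{p'}`, where `p' = min p 2`. -/
noncomputable def weightedSum (d : ℕ → ℕ → ℝ≥0) (k : ℕ → ℕ) (p b : ℝ) (n : ℕ) : ℝ≥0∞ :=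
  ∑' s : ℕ, (Finset.Icc 1 (k n)).sup fun i =>
    ((d i (s + 1) : ℝ≥0∞) / ((s + 1 : ℕ) : ℝ≥0∞) ^ b) ^ (min p 2)

/-- `limsup_n max_{1 ≤ i ≤ k_n, 1 ≤ t ≤ n} ‖x_{i,t}‖_p`. -/
noncomputable def dBar (μ : Measure Ω) (x : ℕ → ℕ → Ω → ℝ) (k : ℕ → ℕ) (p : ℝ) : ℝ≥0∞ :=
  limsup (fun n : ℕ => (Finset.Icc 1 (k n)).sup fun i => (Finset.Icc 1 n).sup fun t =>
    eLpNorm (x i t) (ENNReal.ofReal p) μ) atTop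

/-- `limsup_{p → ∞} p^{1/2 - 1/α} dBar^{(α p)} ∑_{m ≥ 0} ψ_{i,m}`. -/
noncomputable def gammaRing (μ : Measure Ω) (x : ℕ → ℕ → Ω → ℝ) (k : ℕ → ℕ)
    (ψ : ℕ → ℕ → ℝ≥0) (α : ℝ) (i : ℕ) : ℝ≥0∞ :=
  limsup (fun p : ℝ => ENNReal.ofReal (p ^ (1 / 2 - 1 / α)) * dBar μ x k (α * p) *
    ∑' m : ℕ, (ψ i m : ℝ≥0∞)) atTop

end MaxLLN

/-!
Fix a coordinate `i` and let `F_s` be the `σ`-algebra generated by `(ε_{i,r})_{r ≤ s}`. The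
variable `x_{i,t}` is the sum over `m ≥ 0` of its projections `P_{t-m} x_{i,t} = E[x_{i,t} |
F_{t-m}] - E[x_{i,t} | F_{t-m-1}]`, and three facts turn this into a maximal inequality for the
partial sums.

* Replacing `ε_{i,t-m}` by an independent copy before conditioning on `F_{t-m}` has the same
  effect as conditioning on `F_{t-m-1}` (`condExp_coupled`), so `‖P_{t-m} x_{i,t}‖_p ≤ θ_{i,t}(m)`
  (`eLpNorm_proj_le_theta`).
* For fixed `m` the projections are martingale differences in `t`. With `p' = min p 2`, the
  two-point inequality `|x + y|^p + |x - y|^p ≤ 2 (|x|^p' + 2p |y|^p')^(p/p')`, integrated with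
  Minkowski's inequality, gives `‖S + D‖_p^p' + ‖S - D‖_p^p' ≤ 2 (‖S‖_p^p' + 2p ‖D‖_p^p')`. If `D`
  has zero conditional mean then `‖S - D‖_p ≥ ‖S‖_p`, whence `‖S + D‖_p^p' ≤ ‖S‖_p^p' + 4p
  ‖D‖_p^p'` (`eLpNorm_add_le_of_condExp_eq_zero`). Iterating this and applying Doob's `L^p`
  inequality bounds the running maximum for every `m` (`eLpNorm_runMax_partialSum_le`); the
  constant is of order `p^(1/2)` as `p → ∞`, which is what the second part needs.
* The remainder `E[x_{i,t} | F_{t-K}]` tends to `0` in `L¹`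
  (`tendsto_eLpNorm_condExp_remote_past`).

Summing over `m` yields `measure_le_runMax_le`, a bound of `P(max_{n ≤ N} |∑_{t ≤ n} x_{i,t}| ≥
r)` by a multiple of `((∑_{t ≤ N} d_{i,t}^p')^(1/p') ∑_m ψ_{i,m} / r)^p`. A union bound over `i ≤
k_N` with `N = 2^l` and the Borel–Cantelli lemma (`ae_tendsto_maxMean`) reduce the theorem to the
summability over `l` of explicit quantities.

In part (a) under the bound on the weighted sums, `k_N = O(N^(p(1-b)))` unless all moments vanish,
and the weighted averages `∑_{t ≤ N} (t/N)^(bp') D_t` of a summable sequence `D` are summable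
along `N = 2^l` (`tsum_weighted_average_ne_top`). If instead `d_{i,t} ≤ 2 ‖x_{i,t}‖_p`, the terms
are of order `N^(-p(b-1/p'))`. In part (b) the moments satisfy `‖x_{i,t}‖_q ≤ L q^(1/α-1/2)`, and
the choice `q = a N^(α/2)` with a small constant `a` gives probabilities of at most `e^(-q)`
(`measure_le_runMax_le_exp`), which outweigh `k_N`.
-/

namespace MaxLLN

/-! ### The smoothness inequality in `L^p` and Doob's argument -/

section

theorem abs_rpow_eq_sq_rpow (x p : ℝ) : |x| ^ p = (x ^ 2) ^ (p / 2) := by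
  rw [← sq_abs, ← Real.rpow_natCast, ← Real.rpow_mul (abs_nonneg x)]
  congr 1
  push_cast
  ring

/-- The two-point inequality with first point `1`. For `p y² ≤ 1` the left side is at most
`2 cosh (p y)`, a sub-Gaussian function of `y`; for larger `y` each term is dominated separately. -/
theorem two_point_one {p : ℝ} (hp : 2 ≤ p) (y : ℝ) :
    |1 + y| ^ p + |1 - y| ^ p ≤ 2 * (1 + 2 * p * y ^ 2) ^ (p / 2) := by
  have hp0 : 0 < p := by linarith
  rcases le_total (p * y ^ 2) 1 with h | h
  · have hy : |y| ≤ 1 := by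
      rw [← sq_le_one_iff_abs_le_one]; nlinarith [sq_nonneg y]
    obtain ⟨hy1, hy2⟩ := abs_le.1 hy
    have key : ∀ u : ℝ, 0 ≤ 1 + u → |1 + u| ^ p ≤ Real.exp (p * u) := by
      intro u hu
      rw [abs_of_nonneg hu, mul_comm, Real.exp_mul]
      exact Real.rpow_le_rpow hu (by linarith [Real.add_one_le_exp u]) hp0.le
    have h1 := key y (by linarith)
    have h2 := key (-y) (by linarith)
    have h3 := Real.cosh_le_exp_half_sq (p * y)
    rw [Real.cosh_eq] at h3
    have h4 : Real.exp ((p * y) ^ 2 / 2) = Real.exp (p * y ^ 2) ^ (p / 2) := by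
      rw [← Real.exp_mul]; congr 1; ring
    have h5 : Real.exp (p * y ^ 2) ≤ 1 + 2 * p * y ^ 2 := by
      have h0 : 0 ≤ p * y ^ 2 := by positivity
      have := Real.abs_exp_sub_one_sub_id_le (x := p * y ^ 2) (by rwa [abs_of_nonneg h0])
      have := (abs_le.1 this).2
      nlinarith
    have h6 := Real.rpow_le_rpow (Real.exp_pos _).le h5 (by positivity : 0 ≤ p / 2)
    rw [sub_eq_add_neg]
    rw [mul_neg] at h2
    linarith
  · have key : ∀ u : ℝ, 1 ≤ p * u ^ 2 → |1 + u| ^ p ≤ (1 + 2 * p * u ^ 2) ^ (p / 2) := by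
      intro u hu
      rw [abs_rpow_eq_sq_rpow]
      refine Real.rpow_le_rpow (sq_nonneg _) ?_ (by positivity)
      have h1 : 2 * u ^ 2 ≤ p * u ^ 2 := by gcongr
      have h2 : 2 * u ≤ 3 / 2 * (p * u ^ 2) := by
        refine le_of_sq_le_sq ?_ (by positivity)
        nlinarith
      nlinarith
    have h1 := key y h
    have h2 := key (-y) (by simpa using h)
    rw [neg_sq] at h2
    rw [sub_eq_add_neg]
    linarith

theorem two_point_of_two_le {p : ℝ} (hp : 2 ≤ p) (x y : ℝ) :
    |x + y| ^ p + |x - y| ^ p ≤ 2 * (x ^ 2 + 2 * p * y ^ 2) ^ (p / 2) := by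
  rcases eq_or_ne x 0 with rfl | hx
  · have : |y| ^ p ≤ (0 ^ 2 + 2 * p * y ^ 2) ^ (p / 2) := by
      rw [abs_rpow_eq_sq_rpow]
      exact Real.rpow_le_rpow (sq_nonneg _) (by nlinarith [sq_nonneg y]) (by linarith)
    simp only [zero_add, zero_sub, abs_neg] at this ⊢
    linarith
  · have h := two_point_one hp (y / x)
    have h1 : |x + y| ^ p = |x| ^ p * |1 + y / x| ^ p := by
      rw [← Real.mul_rpow (abs_nonneg _) (abs_nonneg _), ← abs_mul]
      congr 2; field_simp
    have h2 : |x - y| ^ p = |x| ^ p * |1 - y / x| ^ p := by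
      rw [← Real.mul_rpow (abs_nonneg _) (abs_nonneg _), ← abs_mul]
      congr 2; field_simp
    have h3 : (x ^ 2 + 2 * p * y ^ 2) ^ (p / 2)
        = |x| ^ p * (1 + 2 * p * (y / x) ^ 2) ^ (p / 2) := by
      rw [abs_rpow_eq_sq_rpow, ← Real.mul_rpow (by positivity) (by positivity)]
      congr 1; field_simp
    rw [h1, h2, h3]
    have := mul_le_mul_of_nonneg_left h (by positivity : 0 ≤ |x| ^ p)
    linarith

theorem two_point_of_le_two {p : ℝ} (hp0 : 0 ≤ p) (hp : p ≤ 2) (x y : ℝ) :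
    |x + y| ^ p + |x - y| ^ p ≤ 2 * (|x| ^ p + |y| ^ p) := by
  have hc := (Real.concaveOn_rpow (p := p / 2) (by linarith) (by linarith)).2
    (Set.mem_Ici.2 (sq_nonneg (x + y))) (Set.mem_Ici.2 (sq_nonneg (x - y)))
    (by norm_num : (0 : ℝ) ≤ 1 / 2) (by norm_num : (0 : ℝ) ≤ 1 / 2) (by norm_num)
  have hs := Real.rpow_add_le_add_rpow (p := p / 2) (sq_nonneg x) (sq_nonneg y) (by linarith)
    (by linarith)
  simp only [smul_eq_mul] at hc
  have he : 1 / 2 * (x + y) ^ 2 + 1 / 2 * (x - y) ^ 2 = x ^ 2 + y ^ 2 := by ring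
  rw [he] at hc
  simp only [abs_rpow_eq_sq_rpow]
  linarith

/-- The two-point smoothness inequality for `p ≥ 1`; the factor `2 p` on the right has the order
in `p` that leads to a moment constant of order `p^(1/2)`. -/
theorem two_point {p : ℝ} (hp : 1 ≤ p) (x y : ℝ) :
    |x + y| ^ p + |x - y| ^ p
      ≤ 2 * (|x| ^ (min p 2) + 2 * p * |y| ^ (min p 2)) ^ (p / min p 2) := by
  rcases le_total p 2 with h | h
  · rw [min_eq_left h, div_self (by linarith), Real.rpow_one]
    have := two_point_of_le_two (by linarith) h x y
    have h0 : 0 ≤ |y| ^ p := by positivity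
    nlinarith
  · rw [min_eq_right h]
    simpa using two_point_of_two_le h x y

theorem two_point_enorm {p : ℝ} (hp : 1 ≤ p) (x y : ℝ) :
    ‖x + y‖ₑ ^ p + ‖x - y‖ₑ ^ p
      ≤ 2 * (‖x‖ₑ ^ (min p 2) + ENNReal.ofReal (2 * p) * ‖y‖ₑ ^ (min p 2)) ^ (p / min p 2) := by
  have hp0 : 0 ≤ p := by linarith
  have hm : 0 ≤ min p 2 := le_min hp0 (by norm_num)
  have h := ENNReal.ofReal_le_ofReal (two_point hp x y)
  rw [ENNReal.ofReal_mul (by norm_num), ENNReal.ofReal_add (by positivity) (by positivity),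
    ← ENNReal.ofReal_rpow_of_nonneg (p := p / min p 2) (by positivity) (by positivity),
    ENNReal.ofReal_add (by positivity) (by positivity),
    ENNReal.ofReal_mul (p := 2 * p) (by positivity)] at h
  simp only [← ENNReal.ofReal_rpow_of_nonneg (abs_nonneg _) hp0,
    ← ENNReal.ofReal_rpow_of_nonneg (abs_nonneg _) hm] at h
  simpa [Real.enorm_eq_ofReal_abs] using h

variable {Ω : Type*} {m0 : MeasurableSpace Ω} {μ : Measure Ω}

theorem eLpNorm_ofReal_rpow {p : ℝ} (hp : 0 < p) (f : Ω → ℝ) :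
    eLpNorm f (ENNReal.ofReal p) μ ^ p = ∫⁻ ω, ‖f ω‖ₑ ^ p ∂μ := by
  rw [eLpNorm_eq_lintegral_rpow_enorm_toReal (by simpa using hp) (by simp),
    ENNReal.toReal_ofReal hp.le, ← ENNReal.rpow_mul, one_div, inv_mul_cancel₀ hp.ne',
    ENNReal.rpow_one]

/-- The two-point inequality in `L^p`: a form of the uniform smoothness of `L^p` with exponent
`min p 2`. -/
theorem eLpNorm_two_point {p : ℝ} (hp : 1 ≤ p) {f g : Ω → ℝ} (hf : AEStronglyMeasurable f μ)
    (hg : AEStronglyMeasurable g μ) :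
    eLpNorm (f + g) (ENNReal.ofReal p) μ ^ (min p 2)
        + eLpNorm (f - g) (ENNReal.ofReal p) μ ^ (min p 2)
      ≤ 2 * (eLpNorm f (ENNReal.ofReal p) μ ^ (min p 2)
        + ENNReal.ofReal (2 * p) * eLpNorm g (ENNReal.ofReal p) μ ^ (min p 2)) := by
  have hp0 : 0 < p := by linarith
  set s := min p 2 with hs
  have hs0 : 0 < s := lt_min hp0 (by norm_num)
  -- Minkowski's inequality is applied to `|f|^s` and `2 p |g|^s` in `L^r`, where `r = p / s ≥ 1`.
  set r := p / s with hr
  have hr1 : 1 ≤ r := by rw [hr, le_div_iff₀ hs0, one_mul]; exact min_le_left _ _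
  have hr0 : 0 < r := by linarith
  have hsr : s * r = p := by rw [hr]; field_simp
  have hN : ∀ h : Ω → ℝ, eLpNorm h (ENNReal.ofReal p) μ ^ s
      = (∫⁻ ω, ‖h ω‖ₑ ^ p ∂μ) ^ (1 / r) := by
    intro h
    rw [← eLpNorm_ofReal_rpow hp0, ← ENNReal.rpow_mul]
    congr 1; rw [← hsr]; field_simp
  have hu : AEMeasurable (fun ω => ‖f ω‖ₑ ^ s) μ := hf.enorm.pow_const _
  have hv : AEMeasurable (fun ω => ENNReal.ofReal (2 * p) * ‖g ω‖ₑ ^ s) μ :=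
    (hg.enorm.pow_const _).const_mul _
  have hmink := ENNReal.lintegral_Lp_add_le hu hv hr1
  have e1 : (∫⁻ ω, (‖f ω‖ₑ ^ s) ^ r ∂μ) ^ (1 / r) = eLpNorm f (ENNReal.ofReal p) μ ^ s := by
    rw [hN]; simp_rw [← ENNReal.rpow_mul, hsr]
  have e2 : (∫⁻ ω, (ENNReal.ofReal (2 * p) * ‖g ω‖ₑ ^ s) ^ r ∂μ) ^ (1 / r)
      = ENNReal.ofReal (2 * p) * eLpNorm g (ENNReal.ofReal p) μ ^ s := by
    rw [hN]
    simp_rw [ENNReal.mul_rpow_of_nonneg _ _ hr0.le, ← ENNReal.rpow_mul, hsr]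
    rw [lintegral_const_mul'' _ (hg.enorm.pow_const _),
      ENNReal.mul_rpow_of_nonneg _ _ (by positivity), ← ENNReal.rpow_mul]
    rw [mul_one_div_cancel hr0.ne', ENNReal.rpow_one]
  rw [e1, e2] at hmink
  refine le_trans ?_ (mul_le_mul_right hmink 2)
  have hI : (∫⁻ ω, ‖(f + g) ω‖ₑ ^ p ∂μ) + ∫⁻ ω, ‖(f - g) ω‖ₑ ^ p ∂μ
      ≤ 2 * ∫⁻ ω, ((fun ω => ‖f ω‖ₑ ^ s)
        + fun ω => ENNReal.ofReal (2 * p) * ‖g ω‖ₑ ^ s) ω ^ r ∂μ := by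
    rw [← lintegral_add_left' ((hf.add hg).enorm.pow_const _),
      ← lintegral_const_mul' _ _ (by simp)]
    exact lintegral_mono fun ω => two_point_enorm hp (f ω) (g ω)
  set I := ∫⁻ ω, ((fun ω => ‖f ω‖ₑ ^ s)
        + fun ω => ENNReal.ofReal (2 * p) * ‖g ω‖ₑ ^ s) ω ^ r ∂μ
  rw [hN, hN]
  set a := ∫⁻ ω, ‖(f + g) ω‖ₑ ^ p ∂μ
  set b := ∫⁻ ω, ‖(f - g) ω‖ₑ ^ p ∂μ
  have hab := ENNReal.rpow_add_le_mul_rpow_add_rpow (a ^ (1 / r)) (b ^ (1 / r)) hr1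
  rw [← ENNReal.rpow_mul, ← ENNReal.rpow_mul, one_div_mul_cancel hr0.ne', ENNReal.rpow_one,
    ENNReal.rpow_one] at hab
  rw [← ENNReal.rpow_le_rpow_iff hr0]
  refine hab.trans ((mul_le_mul_right hI _).trans ?_)
  rw [ENNReal.mul_rpow_of_nonneg _ _ hr0.le, ← ENNReal.rpow_mul, one_div_mul_cancel hr0.ne',
    ENNReal.rpow_one, ← mul_assoc]
  gcongr
  have h2 := ENNReal.rpow_add (r - 1) 1 two_ne_zero ENNReal.ofNat_ne_top
  rw [sub_add_cancel, ENNReal.rpow_one] at h2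
  exact h2.ge

/-- One step of the martingale moment inequality: by the contraction property of the conditional
expectation `‖S‖_p ≤ ‖S - D‖_p`, so the two-point inequality bounds `‖S + D‖_p` alone. -/
theorem eLpNorm_add_le_of_condExp_eq_zero [IsFiniteMeasure μ] {m : MeasurableSpace Ω} (hm : m ≤ m0)
    {p : ℝ} (hp : 1 ≤ p) {S D : Ω → ℝ} (hS : MemLp S (ENNReal.ofReal p) μ)
    (hD : MemLp D (ENNReal.ofReal p) μ) (hSm : StronglyMeasurable[m] S) (hD0 : μ[D | m] =ᵐ[μ] 0) :
    eLpNorm (S + D) (ENNReal.ofReal p) μ ^ (min p 2)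
      ≤ eLpNorm S (ENNReal.ofReal p) μ ^ (min p 2)
        + ENNReal.ofReal (4 * p) * eLpNorm D (ENNReal.ofReal p) μ ^ (min p 2) := by
  have hs0 : 0 < min p 2 := lt_min (by linarith) (by norm_num)
  have hp1 : 1 ≤ ENNReal.ofReal p := by simpa using hp
  have hc : μ[S - D | m] =ᵐ[μ] S := by
    have h1 := condExp_sub (hS.integrable hp1) (hD.integrable hp1) m
    rw [condExp_of_stronglyMeasurable hm hSm (hS.integrable hp1)] at h1
    filter_upwards [h1, hD0] with ω h1 h2
    simp [h1, h2]
  have hle : eLpNorm S (ENNReal.ofReal p) μ ≤ eLpNorm (S - D) (ENNReal.ofReal p) μ := by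
    rw [← eLpNorm_congr_ae hc]
    exact eLpNorm_condExp_le_eLpNorm _ hp1
  have h := eLpNorm_two_point hp hS.1 hD.1
  have hfin : eLpNorm S (ENNReal.ofReal p) μ ^ (min p 2) ≠ ∞ :=
    ENNReal.rpow_ne_top_of_nonneg hs0.le hS.2.ne
  rw [← ENNReal.add_le_add_iff_right hfin]
  calc _ ≤ _ := add_le_add_right (ENNReal.rpow_le_rpow hle hs0.le) _
    _ ≤ _ := h
    _ = _ := by
      have h4 : ENNReal.ofReal (4 * p) = 2 * ENNReal.ofReal (2 * p) := by
        rw [show 4 * p = 2 * (2 * p) by ring, ENNReal.ofReal_mul two_pos.le, ENNReal.ofReal_ofNat]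
      rw [h4]
      ring

/-- A weak-type bound of `A` by `X` with the integral restricted to `{A ≥ c}`, as in Doob's
maximal inequality, gives the strong bound `‖A‖_p ≤ p / (p - 1) ‖X‖_p`. The layer cake formula is
used for `μ` and for the measure with density `X`, which takes the place of Fubini's theorem. -/
theorem lintegral_rpow_le_of_weak_type {p : ℝ} (hp : 1 < p) {A X : Ω → ℝ} (hA : Measurable A)
    (hX : Measurable X) (hA0 : 0 ≤ A)
    (hfin : ∫⁻ ω, ENNReal.ofReal (A ω) ^ p ∂μ ≠ ∞)
    (h : ∀ c : ℝ, 0 < c → ENNReal.ofReal c * μ {ω | c ≤ A ω}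
      ≤ ∫⁻ ω in {ω | c ≤ A ω}, ENNReal.ofReal (X ω) ∂μ) :
    (∫⁻ ω, ENNReal.ofReal (A ω) ^ p ∂μ) ^ (1 / p)
      ≤ ENNReal.ofReal (p / (p - 1)) * (∫⁻ ω, ENNReal.ofReal (X ω) ^ p ∂μ) ^ (1 / p) := by
  have hp0 : 0 < p := by linarith
  have hp1 : 0 < p - 1 := by linarith
  set q := p / (p - 1) with hq
  have hpq : p.HolderConjugate q := Real.HolderConjugate.conjExponent hp
  have hXm : Measurable fun ω => ENNReal.ofReal (X ω) := hX.ennreal_ofReal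
  -- Under `ν` the weak-type bound reads `c μ {A ≥ c} ≤ ν {A ≥ c}`.
  set ν := μ.withDensity fun ω => ENNReal.ofReal (X ω) with hν
  have h1 := lintegral_rpow_eq_lintegral_meas_le_mul μ (Eventually.of_forall hA0) hA.aemeasurable hp0
  have h2 := lintegral_rpow_eq_lintegral_meas_le_mul ν (Eventually.of_forall hA0) hA.aemeasurable hp1
  have h3 : ∫⁻ t in Set.Ioi (0 : ℝ), μ {a | t ≤ A a} * ENNReal.ofReal (t ^ (p - 1))
      ≤ ∫⁻ t in Set.Ioi (0 : ℝ), ν {a | t ≤ A a} * ENNReal.ofReal (t ^ (p - 1 - 1)) := by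
    refine setLIntegral_mono' measurableSet_Ioi fun t (ht : 0 < t) => ?_
    have h4 := h t ht
    rw [← withDensity_apply _ (measurableSet_le measurable_const hA), ← hν] at h4
    have : t ^ (p - 1) = t * t ^ (p - 1 - 1) := by
      rw [Real.rpow_sub_one ht.ne' (p - 1)]; field_simp
    rw [this, ENNReal.ofReal_mul ht.le, ← mul_assoc, mul_comm (μ _)]
    gcongr
  have h5 : ∫⁻ ω, ENNReal.ofReal (A ω ^ p) ∂μ
      ≤ ENNReal.ofReal q * ∫⁻ ω, ENNReal.ofReal (A ω ^ (p - 1)) ∂ν := by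
    rw [h1, h2, ← mul_assoc, ← ENNReal.ofReal_mul (by positivity), hq, div_mul_cancel₀ _ hp1.ne']
    gcongr
  have h6 : ∫⁻ ω, ENNReal.ofReal (A ω ^ (p - 1)) ∂ν
      ≤ (∫⁻ ω, ENNReal.ofReal (X ω) ^ p ∂μ) ^ (1 / p)
        * (∫⁻ ω, ENNReal.ofReal (A ω) ^ p ∂μ) ^ (1 / q) := by
    rw [hν, lintegral_withDensity_eq_lintegral_mul _ hXm (by fun_prop)]
    refine (ENNReal.lintegral_mul_le_Lp_mul_Lq μ hpq hXm.aemeasurable (by fun_prop)).trans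
      (le_of_eq ?_)
    congr 3
    ext ω
    rw [← ENNReal.ofReal_rpow_of_nonneg (hA0 ω) hp1.le, ← ENNReal.rpow_mul, hq,
      mul_div_cancel₀ _ hp1.ne']
  have h7 : ∫⁻ ω, ENNReal.ofReal (A ω ^ p) ∂μ = ∫⁻ ω, ENNReal.ofReal (A ω) ^ p ∂μ := by
    congr with ω
    rw [ENNReal.ofReal_rpow_of_nonneg (hA0 ω) hp0.le]
  rw [h7] at h5
  set I := ∫⁻ ω, ENNReal.ofReal (A ω) ^ p ∂μ
  rcases eq_or_ne I 0 with h0 | h0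
  · rw [h0, ENNReal.zero_rpow_of_pos (by positivity)]; exact zero_le
  have h8 : I ^ (1 / p) * I ^ (1 / q) = I := by
    rw [← ENNReal.rpow_add _ _ h0 hfin, one_div, one_div, hpq.inv_add_inv_eq_one, ENNReal.rpow_one]
  have hIq0 : I ^ (1 / q) ≠ 0 := by
    intro h; rw [ENNReal.rpow_eq_zero_iff] at h; tauto
  have hq0 : 0 < q := by positivity
  have hIqt : I ^ (1 / q) ≠ ∞ := ENNReal.rpow_ne_top_of_nonneg (by positivity) hfin
  refine (ENNReal.mul_le_mul_iff_left hIq0 hIqt).1 ?_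
  rw [h8, mul_assoc]
  exact h5.trans (mul_le_mul_right h6 _)

end

/-! ### Maximal moment inequality for martingale differences -/

section

variable {Ω : Type*} {m0 : MeasurableSpace Ω} {μ : Measure Ω}

/-- The running maximum `max_{n ≤ N} |S_n|`. -/
noncomputable def runMax (S : ℕ → Ω → ℝ) (N : ℕ) (ω : Ω) : ℝ :=
  (Finset.range (N + 1)).sup' Finset.nonempty_range_add_one fun n => |S n ω|

theorem le_runMax (S : ℕ → Ω → ℝ) {n N : ℕ} (h : n ≤ N) (ω : Ω) : |S n ω| ≤ runMax S N ω :=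
  Finset.le_sup' (fun n => |S n ω|) (Finset.mem_range.2 (Nat.lt_succ_of_le h))

theorem runMax_le {S : ℕ → Ω → ℝ} {N : ℕ} {ω : Ω} {c : ℝ} (h : ∀ n ≤ N, |S n ω| ≤ c) :
    runMax S N ω ≤ c :=
  Finset.sup'_le _ _ fun n hn => h n (Nat.lt_succ_iff.1 (Finset.mem_range.1 hn))

theorem runMax_nonneg (S : ℕ → Ω → ℝ) (N : ℕ) : 0 ≤ runMax S N :=
  fun ω => (abs_nonneg _).trans (le_runMax S (Nat.zero_le N) ω)

theorem measurable_runMax {S : ℕ → Ω → ℝ} (hS : ∀ n, Measurable (S n)) (N : ℕ) :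
    Measurable (runMax S N) := by
  have := Finset.measurable_range_sup'' (f := fun n ω => |S n ω|) (n := N)
    fun n _ => (hS n).abs
  exact this

theorem memLp_runMax {q : ℝ≥0∞} {S : ℕ → Ω → ℝ} (hS : ∀ n, Measurable (S n))
    (hq : ∀ n, MemLp (S n) q μ) (N : ℕ) : MemLp (runMax S N) q μ := by
  have h1 : MemLp (fun ω => ∑ n ∈ Finset.range (N + 1), |S n ω|) q μ :=
    memLp_finsetSum _ fun n _ => (hq n).abs
  refine h1.mono' (measurable_runMax hS N).aestronglyMeasurable (ae_of_all _ fun ω => ?_)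
  rw [Real.norm_of_nonneg (runMax_nonneg S N ω)]
  refine runMax_le fun n hn => ?_
  exact Finset.single_le_sum (f := fun n => |S n ω|) (fun _ _ => abs_nonneg _)
    (Finset.mem_range.2 (Nat.lt_succ_of_le hn))

/-- **Doob's `L^p` maximal inequality**. -/
theorem eLpNorm_runMax_le [IsFiniteMeasure μ] {𝒢 : Filtration ℕ m0} {p : ℝ} (hp : 1 < p)
    {S : ℕ → Ω → ℝ} (hS : Martingale S 𝒢 μ) (hq : ∀ n, MemLp (S n) (ENNReal.ofReal p) μ) (N : ℕ) :
    eLpNorm (runMax S N) (ENNReal.ofReal p) μ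
      ≤ ENNReal.ofReal (p / (p - 1)) * eLpNorm (S N) (ENNReal.ofReal p) μ := by
  have hp0 : 0 < p := by linarith
  have hSm : ∀ n, Measurable (S n) := fun n => ((hS.stronglyMeasurable n).mono (𝒢.le n)).measurable
  have hsub : Submartingale (fun n ω => |S n ω|) 𝒢 μ := by
    have := hS.submartingale.sup hS.neg.submartingale
    exact this
  have hnorm : ∀ f : Ω → ℝ, eLpNorm f (ENNReal.ofReal p) μ
      = (∫⁻ ω, ENNReal.ofReal |f ω| ^ p ∂μ) ^ (1 / p) := by
    intro f
    rw [eLpNorm_eq_lintegral_rpow_enorm_toReal (by simpa using hp0) (by simp),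
      ENNReal.toReal_ofReal hp0.le]
    simp only [Real.enorm_eq_ofReal_abs]
  have habs : ∀ ω, |runMax S N ω| = runMax S N ω := fun ω => abs_of_nonneg (runMax_nonneg S N ω)
  rw [hnorm, hnorm]
  simp only [habs]
  refine lintegral_rpow_le_of_weak_type hp (measurable_runMax hSm N) (hSm N).abs
    (runMax_nonneg S N) ?_ fun c hc => ?_
  · have h := (memLp_runMax hSm hq N).2
    rw [hnorm] at h
    simp only [habs] at h
    intro h0
    rw [h0, ENNReal.top_rpow_of_pos (by positivity)] at h
    exact absurd h (lt_irrefl _)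
  · have h := maximal_ineq hsub (fun n ω => abs_nonneg _) (ε := c.toNNReal) N
    rw [Real.coe_toNNReal c hc.le] at h
    refine h.trans (le_of_eq ?_)
    rw [ofReal_integral_eq_lintegral_ofReal (hsub.integrable N).integrableOn
      (ae_of_all _ fun ω => abs_nonneg _)]
    rfl

/-- Partial sums `∑_{1 ≤ t ≤ n} D_t`. -/
def partialSum (D : ℕ → Ω → ℝ) (n : ℕ) (ω : Ω) : ℝ := ∑ t ∈ Finset.Icc 1 n, D t ω

theorem partialSum_succ (D : ℕ → Ω → ℝ) (n : ℕ) :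
    partialSum D (n + 1) = partialSum D n + D (n + 1) := by
  ext ω
  simp [partialSum, Finset.sum_Icc_succ_top]

theorem partialSum_zero (D : ℕ → Ω → ℝ) : partialSum D 0 = 0 := by
  ext ω; simp [partialSum]

theorem memLp_partialSum {q : ℝ≥0∞} {D : ℕ → Ω → ℝ} (hD : ∀ t, 1 ≤ t → MemLp (D t) q μ) (n : ℕ) :
    MemLp (partialSum D n) q μ :=
  memLp_finsetSum _ fun t ht => hD t (Finset.mem_Icc.1 ht).1

theorem stronglyMeasurable_partialSum {𝒢 : Filtration ℕ m0} {D : ℕ → Ω → ℝ}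
    (hD : ∀ t, 1 ≤ t → StronglyMeasurable[𝒢 t] (D t)) (n : ℕ) :
    StronglyMeasurable[𝒢 n] (partialSum D n) :=
  Finset.stronglyMeasurable_fun_sum _ fun t ht =>
    (hD t (Finset.mem_Icc.1 ht).1).mono (𝒢.mono (Finset.mem_Icc.1 ht).2)

theorem martingale_partialSum [IsFiniteMeasure μ] {𝒢 : Filtration ℕ m0} {D : ℕ → Ω → ℝ}
    (hDm : ∀ t, 1 ≤ t → StronglyMeasurable[𝒢 t] (D t)) (hDi : ∀ t, 1 ≤ t → Integrable (D t) μ)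
    (hD0 : ∀ t, μ[D (t + 1) | 𝒢 t] =ᵐ[μ] 0) : Martingale (partialSum D) 𝒢 μ := by
  refine martingale_of_condExp_sub_eq_zero_nat (fun n => stronglyMeasurable_partialSum hDm n)
    (fun n => ?_) fun n => ?_
  · rw [← memLp_one_iff_integrable]
    exact memLp_partialSum (fun t ht => memLp_one_iff_integrable.2 (hDi t ht)) n
  · rw [partialSum_succ, add_sub_cancel_left]
    exact hD0 n

/-- The martingale moment inequality: von Bahr–Esseen's for `p ≤ 2` and Rio's for `p ≥ 2`, up to
constants. -/
theorem eLpNorm_partialSum_le [IsFiniteMeasure μ] {𝒢 : Filtration ℕ m0} {p : ℝ} (hp : 1 ≤ p)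
    {D : ℕ → Ω → ℝ} (hDm : ∀ t, 1 ≤ t → StronglyMeasurable[𝒢 t] (D t))
    (hDp : ∀ t, 1 ≤ t → MemLp (D t) (ENNReal.ofReal p) μ)
    (hD0 : ∀ t, μ[D (t + 1) | 𝒢 t] =ᵐ[μ] 0) (n : ℕ) :
    eLpNorm (partialSum D n) (ENNReal.ofReal p) μ ^ (min p 2)
      ≤ ENNReal.ofReal (4 * p)
        * ∑ t ∈ Finset.Icc 1 n, eLpNorm (D t) (ENNReal.ofReal p) μ ^ (min p 2) := by
  have hs0 : 0 < min p 2 := lt_min (by linarith) (by norm_num)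
  induction n with
  | zero => simp [partialSum_zero, hs0]
  | succ n ih =>
    rw [partialSum_succ, Finset.sum_Icc_succ_top (by omega), mul_add]
    exact (eLpNorm_add_le_of_condExp_eq_zero (𝒢.le n) hp (memLp_partialSum hDp n)
      (hDp _ (by omega)) (stronglyMeasurable_partialSum hDm n) (hD0 n)).trans
      (add_le_add_left ih _)

/-- The maximal moment inequality for martingale differences `D_t` with `‖D_t‖_p ≤ a c_t`. -/
theorem eLpNorm_runMax_partialSum_le [IsFiniteMeasure μ] {𝒢 : Filtration ℕ m0} {p : ℝ} (hp : 1 < p)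
    {D : ℕ → Ω → ℝ} (hDm : ∀ t, 1 ≤ t → StronglyMeasurable[𝒢 t] (D t))
    (hDp : ∀ t, 1 ≤ t → MemLp (D t) (ENNReal.ofReal p) μ)
    (hD0 : ∀ t, μ[D (t + 1) | 𝒢 t] =ᵐ[μ] 0) {c : ℕ → ℝ≥0∞} {a : ℝ≥0∞}
    (hc : ∀ t, 1 ≤ t → eLpNorm (D t) (ENNReal.ofReal p) μ ≤ c t * a) (N : ℕ) :
    eLpNorm (runMax (partialSum D) N) (ENNReal.ofReal p) μ
      ≤ ENNReal.ofReal (p / (p - 1)) * (ENNReal.ofReal (4 * p)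
        * ∑ t ∈ Finset.Icc 1 N, c t ^ (min p 2)) ^ (1 / min p 2) * a := by
  have hs0 : 0 < min p 2 := lt_min (by linarith) (by norm_num)
  have hp1 : 1 ≤ ENNReal.ofReal p := by simpa using hp.le
  refine (eLpNorm_runMax_le hp (martingale_partialSum hDm
    (fun t ht => (hDp t ht).integrable hp1) hD0) (memLp_partialSum hDp) N).trans ?_
  rw [mul_assoc]
  gcongr
  rw [← ENNReal.rpow_le_rpow_iff hs0]
  refine (eLpNorm_partialSum_le hp.le hDm hDp hD0 N).trans ?_
  rw [ENNReal.mul_rpow_of_nonneg _ _ hs0.le, ← ENNReal.rpow_mul, one_div_mul_cancel hs0.ne',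
    ENNReal.rpow_one, mul_assoc, Finset.sum_mul]
  gcongr with t ht
  rw [← ENNReal.mul_rpow_of_nonneg _ _ hs0.le]
  exact ENNReal.rpow_le_rpow (hc t (Finset.mem_Icc.1 ht).1) hs0.le

end

/-! ### Conditioning on the past of an i.i.d. sequence -/

section

section Freezing

variable {Ω α β γ : Type*} {m0 : MeasurableSpace Ω} {μ : Measure Ω}
  [MeasurableSpace α] [MeasurableSpace β] [MeasurableSpace γ]

/-- The freezing lemma: conditioning on `Y` fixes `Y` and integrates out an independent `X`. -/
theorem condExp_comp_prod_of_indepFun [IsProbabilityMeasure μ] {X : Ω → α} {Y : Ω → β}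
    (hX : Measurable X) (hY : Measurable Y) (hXY : IndepFun X Y μ) {F : α × β → ℝ}
    (hF : Measurable F) (hint : Integrable (fun ω => F (X ω, Y ω)) μ) :
    μ[fun ω => F (X ω, Y ω) | MeasurableSpace.comap Y inferInstance]
      =ᵐ[μ] fun ω => ∫ a, F (a, Y ω) ∂(μ.map X) := by
  have : IsProbabilityMeasure (μ.map X) := Measure.isProbabilityMeasure_map hX.aemeasurable
  have : IsProbabilityMeasure (μ.map Y) := Measure.isProbabilityMeasure_map hY.aemeasurable
  have hprod := (indepFun_iff_map_prod_eq_prod_map_map hX.aemeasurable hY.aemeasurable).1 hXY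
  have hXYm : Measurable fun ω => (X ω, Y ω) := hX.prodMk hY
  have hint' : Integrable F ((μ.map X).prod (μ.map Y)) := by
    rw [← hprod, integrable_map_measure hF.aestronglyMeasurable hXYm.aemeasurable]
    exact hint
  have hh : StronglyMeasurable fun y : β => ∫ a, F (a, y) ∂(μ.map X) :=
    hF.stronglyMeasurable.integral_prod_left'
  have hhint : Integrable (fun y : β => ∫ a, F (a, y) ∂(μ.map X)) (μ.map Y) :=
    hint'.integral_prod_right
  have hhint' : Integrable (fun ω => ∫ a, F (a, Y ω) ∂(μ.map X)) μ :=
    (integrable_map_measure hh.aestronglyMeasurable hY.aemeasurable).1 hhint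
  refine (ae_eq_condExp_of_forall_setIntegral_eq hY.comap_le hint
    (fun s _ _ => hhint'.integrableOn) ?_ ?_).symm
  · rintro _ ⟨B, hB, rfl⟩ -
    have e1 : ∫ ω in Y ⁻¹' B, F (X ω, Y ω) ∂μ
        = ∫ z in Set.univ ×ˢ B, F z ∂((μ.map X).prod (μ.map Y)) := by
      rw [← hprod, setIntegral_map (MeasurableSet.univ.prod hB) hF.aestronglyMeasurable
        hXYm.aemeasurable]
      congr 2
      ext ω; simp
    have e2 : ∫ ω in Y ⁻¹' B, ∫ a, F (a, Y ω) ∂(μ.map X) ∂μ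
        = ∫ y in B, ∫ a, F (a, y) ∂(μ.map X) ∂(μ.map Y) := by
      rw [setIntegral_map hB hh.aestronglyMeasurable hY.aemeasurable]
    rw [e1, e2, ← Measure.prod_restrict, Measure.restrict_univ, integral_prod_symm]
    rw [← Measure.restrict_univ (μ := μ.map X), Measure.prod_restrict]
    exact hint'.integrableOn
  · exact (hh.comp_measurable (comap_measurable Y)).aestronglyMeasurable

theorem indepFun_prodMk_left [IsProbabilityMeasure μ] {A : Ω → α} {U : Ω → β}
    {W : Ω → γ} (hA : Measurable A) (hU : Measurable U) (hW : Measurable W) (hUW : IndepFun U W μ)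
    (hAUW : IndepFun A (fun ω => (U ω, W ω)) μ) : IndepFun (fun ω => (A ω, U ω)) W μ := by
  have : IsProbabilityMeasure (μ.map A) := Measure.isProbabilityMeasure_map hA.aemeasurable
  have : IsProbabilityMeasure (μ.map U) := Measure.isProbabilityMeasure_map hU.aemeasurable
  have : IsProbabilityMeasure (μ.map W) := Measure.isProbabilityMeasure_map hW.aemeasurable
  have h1 := (indepFun_iff_map_prod_eq_prod_map_map hU.aemeasurable hW.aemeasurable).1 hUW
  have h2 := (indepFun_iff_map_prod_eq_prod_map_map hA.aemeasurable
    (hU.prodMk hW).aemeasurable).1 hAUW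
  have h3 := (indepFun_iff_map_prod_eq_prod_map_map hA.aemeasurable hU.aemeasurable).1
    (hAUW.comp measurable_id measurable_fst)
  refine (indepFun_iff_map_prod_eq_prod_map_map (hA.prodMk hU).aemeasurable hW.aemeasurable).2 ?_
  change μ.map (fun ω => (A ω, U ω)) = (μ.map A).prod (μ.map U) at h3
  rw [h3]
  rw [h1] at h2
  have h4 := congrArg (Measure.map MeasurableEquiv.prodAssoc.symm) h2
  rw [Measure.map_map (MeasurableEquiv.measurable _) (hA.prodMk (hU.prodMk hW))] at h4
  have h5 : Measure.map MeasurableEquiv.prodAssoc.symm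
      ((μ.map A).prod ((μ.map U).prod (μ.map W))) = ((μ.map A).prod (μ.map U)).prod (μ.map W) := by
    rw [← Measure.prodAssoc_prod, MeasurableEquiv.map_symm_map]
  rw [h5] at h4
  exact h4

end Freezing

section Past

variable {Ω S : Type*}

/-- The sequence `(e_s, e_{s-1}, …)`. -/
def past (e : ℤ → Ω → S) (s : ℤ) (ω : Ω) : ℕ → S := fun j => e (s - j) ω

/-- The sequence `(e_{s+1}, e_{s+2}, …)`. -/
def future (e : ℤ → Ω → S) (s : ℤ) (ω : Ω) : ℕ → S := fun j => e (s + 1 + j) ω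

/-- The sequence `(u_{m-1}, …, u_0, v_0, v_1, …)`. -/
def glue (m : ℕ) (u v : ℕ → S) : ℕ → S := fun j => if j < m then u (m - 1 - j) else v (j - m)

/-- The sequence `(a, v_0, v_1, …)`. -/
def consSeq (a : S) (v : ℕ → S) : ℕ → S
  | 0 => a
  | j + 1 => v j

theorem past_eq_glue (e : ℤ → Ω → S) (s : ℤ) (m : ℕ) (ω : Ω) :
    past e (s + m) ω = glue m (future e s ω) (past e s ω) := by
  ext j
  simp only [past, glue, future]
  split_ifs with h
  all_goals congr 1; omega

theorem past_eq_consSeq (e : ℤ → Ω → S) (s : ℤ) (ω : Ω) :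
    past e s ω = consSeq (e s ω) (past e (s - 1) ω) := by
  ext j
  cases j with
  | zero => simp [past, consSeq]
  | succ j => simp only [past, consSeq]; congr 1; push_cast; ring

variable [mS : MeasurableSpace S]

theorem measurable_glue (m : ℕ) : Measurable fun z : (ℕ → S) × (ℕ → S) => glue m z.1 z.2 := by
  refine measurable_pi_iff.2 fun j => ?_
  unfold glue
  split_ifs <;> fun_prop

theorem measurable_consSeq : Measurable fun z : S × (ℕ → S) => consSeq z.1 z.2 := by
  refine measurable_pi_iff.2 fun j => ?_
  cases j
  · exact measurable_fst
  · simp only [consSeq]; fun_prop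

theorem comap_pi_le (m : MeasurableSpace Ω) {F : Ω → ℕ → S} (h : ∀ j, Measurable fun ω => F ω j) :
    MeasurableSpace.comap F inferInstance ≤ m :=
  Measurable.comap_le (measurable_pi_iff.2 h)

variable {m0 : MeasurableSpace Ω} {μ : Measure Ω} {e e' : ℤ → Ω → S}

theorem measurable_past (he : ∀ s, Measurable (e s)) (s : ℤ) : Measurable (past e s) :=
  measurable_pi_iff.2 fun _ => he _

theorem measurable_future (he : ∀ s, Measurable (e s)) (s : ℤ) : Measurable (future e s) :=
  measurable_pi_iff.2 fun _ => he _

/-- The `σ`-algebra of the past `(e_r)_{r ≤ s}`. -/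
@[reducible] def pastSigma (e : ℤ → Ω → S) (s : ℤ) : MeasurableSpace Ω :=
  MeasurableSpace.comap (past e s) inferInstance

theorem pastSigma_le (he : ∀ s, Measurable (e s)) (s : ℤ) : pastSigma e s ≤ m0 :=
  (measurable_past he s).comap_le

theorem measurable_pastSigma {r s : ℤ} (h : r ≤ s) : Measurable[pastSigma e s] (e r) := by
  have h1 : Measurable[pastSigma e s] (past e s) := comap_measurable _
  have h2 := (measurable_pi_apply (s - r).toNat).comp h1
  have h3 : (fun v : ℕ → S => v (s - r).toNat) ∘ past e s = e r := by
    ext ω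
    simp only [past, Function.comp]
    congr 1; omega
  rwa [h3] at h2

theorem pastSigma_mono : Monotone (pastSigma e) := by
  intro r s h
  refine comap_pi_le _ fun j => ?_
  exact measurable_pastSigma (by omega)

theorem pastSigma_le_iSup (s : ℤ) :
    pastSigma e s ≤ ⨆ r ∈ Set.Iic s, MeasurableSpace.comap (e r) mS := by
  refine comap_pi_le _ fun j => ?_
  have h : MeasurableSpace.comap (e (s - j)) mS ≤ ⨆ r ∈ Set.Iic s, MeasurableSpace.comap (e r) mS :=
    le_iSup₂_of_le (s - j) (by simp) le_rfl
  exact (comap_measurable (e (s - j))).mono h le_rfl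

theorem indepFun_future_past (he : ∀ s, Measurable (e s)) (hind : iIndepFun e μ) (s : ℤ) :
    IndepFun (future e s) (past e s) μ := by
  have h := indep_iSup_of_disjoint (fun r => (he r).comap_le) hind
    (S := Set.Ioi s) (T := Set.Iic s)
    (Set.disjoint_left.2 fun r hr hr' => absurd (Set.mem_Iic.1 hr') (not_le.2 hr))
  refine indep_of_indep_of_le_left (indep_of_indep_of_le_right h (pastSigma_le_iSup s)) ?_
  refine comap_pi_le _ fun j => ?_
  have h : MeasurableSpace.comap (e (s + 1 + j)) mS
      ≤ ⨆ r ∈ Set.Ioi s, MeasurableSpace.comap (e r) mS :=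
    le_iSup₂_of_le (s + 1 + j) (by simp only [Set.mem_Ioi]; omega) le_rfl
  exact (comap_measurable (e (s + 1 + j))).mono h le_rfl

end Past

section Coupling

variable {Ω S : Type*} [mS : MeasurableSpace S] {m0 : MeasurableSpace Ω} {μ : Measure Ω}
  {e e' : ℤ → Ω → S}

/-- Replacing `e_s` by an independent copy turns the conditional expectation given the past up to
`s` into the conditional expectation of the original variable given the past up to `s - 1`. -/
theorem condExp_coupled [IsProbabilityMeasure μ] (he : ∀ s, Measurable (e s))
    (he' : ∀ s, Measurable (e' s)) (hind : iIndepFun e μ)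
    (hcopy : IndepFun (fun ω t => e t ω) (fun ω t => e' t ω) μ)
    (hid : IdentDistrib (fun ω t => e t ω) (fun ω t => e' t ω) μ μ)
    {f : (ℕ → S) → ℝ} (hf : Measurable f) (s : ℤ) (m : ℕ)
    (hint : Integrable (fun ω => f (past e (s + m) ω)) μ) :
    Integrable (fun ω => f (glue m (future e s ω) (consSeq (e' s ω) (past e (s - 1) ω)))) μ ∧
    μ[fun ω => f (glue m (future e s ω) (consSeq (e' s ω) (past e (s - 1) ω))) | pastSigma e s]
      =ᵐ[μ] μ[fun ω => f (past e (s + m) ω) | pastSigma e (s - 1)] := by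
  have hfut := measurable_future he s
  have hp := measurable_past he s
  have hp' := measurable_past he (s - 1)
  -- With `U` the future of `s`, `A = e_s` and `A' = e'_s`: the pair `(A, U)` is independent of
  -- the past up to `s - 1`, the pair `(A', U)` is independent of the past up to `s`, and both
  -- have the same law, so both conditional expectations freeze the past up to `s - 1` and
  -- integrate out the same law.
  have hi1 : IndepFun (future e s) (past e s) μ := indepFun_future_past he hind s
  have hmU : Measurable fun z : ℤ → S => ((fun j : ℕ => z (s + 1 + j)), fun j : ℕ => z (s - j)) := by
    fun_prop
  have hi2 : IndepFun (e' s) (fun ω => (future e s ω, past e s ω)) μ :=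
    (hcopy.comp hmU (measurable_pi_apply s)).symm
  have hi3 : IndepFun (fun ω => (e' s ω, future e s ω)) (past e s) μ :=
    indepFun_prodMk_left (he' s) hfut hp hi1 hi2
  have hm4 : Measurable fun u : ℕ → S => (u 0, fun j : ℕ => u (j + 1)) := by fun_prop
  have hE : (fun u : ℕ → S => (u 0, fun j : ℕ => u (j + 1))) ∘ future e (s - 1)
      = fun ω => (e s ω, future e s ω) := by
    ext ω : 1
    simp only [Function.comp, future, Prod.mk.injEq]
    constructor
    · congr 1; push_cast; ring
    · ext j; congr 1; push_cast; ring
  have hi4 : IndepFun (fun ω => (e s ω, future e s ω)) (past e (s - 1)) μ := by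
    have := (indepFun_future_past he hind (s - 1)).comp hm4 measurable_id
    rwa [hE] at this
  have hlaw : μ.map (e' s) = μ.map (e s) :=
    ((hid.comp (measurable_pi_apply s)).map_eq).symm
  have hi5 : IndepFun (e s) (future e s) μ :=
    (hi1.comp measurable_id (measurable_pi_apply 0)).symm.congr
    (Eventually.of_forall fun ω => by simp [past]) (ae_eq_refl _)
  have hi6 : IndepFun (e' s) (future e s) μ := hi2.comp measurable_id measurable_fst
  have hlaw2 : μ.map (fun ω => (e' s ω, future e s ω)) = μ.map (fun ω => (e s ω, future e s ω)) := by
    rw [(indepFun_iff_map_prod_eq_prod_map_map (he s).aemeasurable hfut.aemeasurable).1 hi5,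
      (indepFun_iff_map_prod_eq_prod_map_map (he' s).aemeasurable hfut.aemeasurable).1 hi6, hlaw]
  have hF : Measurable fun z : (S × (ℕ → S)) × (ℕ → S) => f (glue m z.1.2 (consSeq z.1.1 z.2)) := by
    have h := measurable_consSeq.comp
      ((measurable_fst.comp measurable_fst).prodMk measurable_snd :
        Measurable fun z : (S × (ℕ → S)) × (ℕ → S) => (z.1.1, z.2))
    exact hf.comp ((measurable_glue m).comp ((measurable_snd.comp measurable_fst).prodMk h))
  have hF' : Measurable fun z : (S × (ℕ → S)) × (ℕ → S) =>
      f (glue m z.1.2 (consSeq z.1.1 fun j => z.2 (j + 1))) := by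
    have h := measurable_consSeq.comp
      ((measurable_fst.comp measurable_fst).prodMk (by fun_prop) :
        Measurable fun z : (S × (ℕ → S)) × (ℕ → S) => (z.1.1, fun j => z.2 (j + 1)))
    exact hf.comp ((measurable_glue m).comp ((measurable_snd.comp measurable_fst).prodMk h))
  have hshift : ∀ ω, (fun j => past e s ω (j + 1)) = past e (s - 1) ω := by
    intro ω; ext j; simp only [past]; congr 1; push_cast; ring
  have hx : ∀ ω, past e (s + m) ω = glue m (future e s ω) (consSeq (e s ω) (past e (s - 1) ω)) := by
    intro ω; rw [past_eq_glue, past_eq_consSeq e s]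
  simp only [hx] at hint ⊢
  have hjoint : μ.map (fun ω => ((e' s ω, future e s ω), past e (s - 1) ω))
      = μ.map (fun ω => ((e s ω, future e s ω), past e (s - 1) ω)) := by
    have hi7 : IndepFun (fun ω => (e' s ω, future e s ω)) (past e (s - 1)) μ := by
      have := hi3.comp measurable_id
        (by fun_prop : Measurable fun (v : ℕ → S) (j : ℕ) => v (j + 1))
      exact this.congr (ae_eq_refl _) (Eventually.of_forall hshift)
    rw [(indepFun_iff_map_prod_eq_prod_map_map ((he' s).prodMk hfut).aemeasurable
      hp'.aemeasurable).1 hi7, (indepFun_iff_map_prod_eq_prod_map_map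
      ((he s).prodMk hfut).aemeasurable hp'.aemeasurable).1 hi4, hlaw2]
  have hint' : Integrable
      (fun ω => f (glue m (future e s ω) (consSeq (e' s ω) (past e (s - 1) ω)))) μ := by
    have h1 := (integrable_map_measure (μ := μ)
      (f := fun ω => ((e s ω, future e s ω), past e (s - 1) ω)) hF.aestronglyMeasurable
      (((he s).prodMk hfut).prodMk hp').aemeasurable).2 hint
    rw [← hjoint] at h1
    exact (integrable_map_measure hF.aestronglyMeasurable
      (((he' s).prodMk hfut).prodMk hp').aemeasurable).1 h1
  refine ⟨hint', ?_⟩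
  have h1 := condExp_comp_prod_of_indepFun ((he s).prodMk hfut) hp' hi4 hF hint
  have h2 := condExp_comp_prod_of_indepFun ((he' s).prodMk hfut) hp hi3 hF'
    (by simpa only [hshift] using hint')
  simp only [hshift] at h2
  rw [hlaw2] at h2
  exact h2.trans h1.symm

/-- The conditional expectations of a centred function of the past given the remote past vanish in
`L¹` in the limit: by Lévy's upward theorem the function is approximated by functions of finitely
many innovations, and these are independent of the remote past. -/
theorem tendsto_eLpNorm_condExp_remote_past [IsProbabilityMeasure μ] (he : ∀ s, Measurable (e s))
    (hind : iIndepFun e μ) {f : (ℕ → S) → ℝ} (hf : Measurable f) (t : ℤ)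
    (hint : Integrable (fun ω => f (past e t ω)) μ) (hmean : ∫ ω, f (past e t ω) ∂μ = 0) :
    Tendsto (fun K : ℕ => eLpNorm (μ[fun ω => f (past e t ω) | pastSigma e (t - K)]) 1 μ) atTop
      (𝓝 0) := by
  set x : Ω → ℝ := fun ω => f (past e t ω) with hx
  -- The `σ`-algebra `𝒦 K` contains the innovations after time `t - K` and is independent of the
  -- past up to that time.
  let 𝒦 : Filtration ℕ m0 :=
    { seq := fun K => ⨆ r ∈ Set.Ioi (t - K), MeasurableSpace.comap (e r) mS
      mono' := fun K L h => biSup_mono fun r (hr : t - K < r) => by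
        have : (K : ℤ) ≤ L := by exact_mod_cast h
        exact lt_of_le_of_lt (by omega) hr
      le' := fun K => iSup₂_le fun r _ => (he r).comap_le }
  have hxm : StronglyMeasurable[⨆ K, 𝒦 K] x := by
    have : Measurable[⨆ K, 𝒦 K] (past e t) := by
      refine measurable_iff_comap_le.2 (comap_pi_le _ fun j => ?_)
      have h : MeasurableSpace.comap (e (t - j)) mS ≤ ⨆ K, 𝒦 K := by
        refine le_iSup_of_le (j + 1) ?_
        exact le_iSup₂_of_le (t - j) (by simp) le_rfl
      exact (comap_measurable (e (t - j))).mono h le_rfl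
    exact (hf.comp this).stronglyMeasurable
  have hlevy := hint.tendsto_eLpNorm_condExp (ℱ := 𝒦) hxm
  refine tendsto_of_tendsto_of_tendsto_of_le_of_le tendsto_const_nhds hlevy (fun _ => zero_le)
    fun K => ?_
  have hle : pastSigma e (t - K) ≤ m0 := pastSigma_le he _
  have hindep : Indep (𝒦 K) (pastSigma e (t - K)) μ := by
    have h := indep_iSup_of_disjoint (fun r => (he r).comap_le) hind
      (S := Set.Ioi (t - K)) (T := Set.Iic (t - K))
      (Set.disjoint_left.2 fun r hr hr' => absurd (Set.mem_Iic.1 hr') (not_le.2 hr))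
    exact indep_of_indep_of_le_right h (pastSigma_le_iSup _)
  have h0 : μ[μ[x | 𝒦 K] | pastSigma e (t - K)] =ᵐ[μ] 0 := by
    have := condExp_indep_eq (𝒦.le K) hle stronglyMeasurable_condExp hindep (f := μ[x | 𝒦 K])
    rw [integral_condExp (𝒦.le K), hmean] at this
    exact this
  have h1 := condExp_sub (μ := μ) (integrable_condExp (m := 𝒦 K) (f := x)) hint (pastSigma e (t - K))
  have h2 : μ[μ[x | 𝒦 K] - x | pastSigma e (t - K)] =ᵐ[μ] -μ[x | pastSigma e (t - K)] := by
    filter_upwards [h0, h1] with ω h0 h1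
    rw [h1]; simp [h0]
  calc eLpNorm (μ[x | pastSigma e (t - K)]) 1 μ
      = eLpNorm (-μ[x | pastSigma e (t - K)]) 1 μ := (eLpNorm_neg _ _ _).symm
    _ = eLpNorm (μ[μ[x | 𝒦 K] - x | pastSigma e (t - K)]) 1 μ := (eLpNorm_congr_ae h2).symm
    _ ≤ eLpNorm (μ[x | 𝒦 K] - x) 1 μ := eLpNorm_condExp_le_eLpNorm _ le_rfl

end Coupling

end

/-! ### Projections and the maximal inequality under physical dependence -/

section

variable {Ω S : Type*} {ε ε' : ℕ → ℤ → Ω → S} {g : ℕ → ℕ → (ℕ → S) → ℝ}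

theorem coupled_eq_glue (i t m : ℕ) (ω : Ω) :
    coupled g ε ε' i t m ω = g i t (glue m (future (ε i) (t - m) ω)
      (consSeq (ε' i (t - m) ω) (past (ε i) (t - m - 1) ω))) := by
  unfold coupled
  congr 1
  ext j
  rcases lt_trichotomy j m with h | rfl | h
  · simp only [h.ne, h, glue, future, if_true, if_false]
    congr 1; omega
  · simp [glue, consSeq]
  · obtain ⟨l, rfl⟩ := Nat.exists_eq_add_of_lt h
    have h1 : ¬ (m + l + 1 < m) := by omega
    have h2 : m + l + 1 ≠ m := by omega
    have h3 : m + l + 1 - m = l + 1 := by omega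
    simp only [h1, h2, h3, glue, consSeq, past, if_false]
    congr 1; push_cast; ring

variable [mS : MeasurableSpace S] {m0 : MeasurableSpace Ω} {μ : Measure Ω}

/-- The projection `P_{t-m} x_t = E[x_t | F_{t-m}] - E[x_t | F_{t-m-1}]`, where `F_s` is the
`σ`-algebra generated by `(e_r)_{r ≤ s}`. -/
noncomputable def proj (μ : Measure Ω) (e : ℤ → Ω → S) (x : ℕ → Ω → ℝ) (m t : ℕ) : Ω → ℝ :=
  μ[x t | pastSigma e (t - m)] - μ[x t | pastSigma e (t - m - 1)]

/-- The filtration `n ↦ F_{n-m}`. -/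
def pastFiltration {e : ℤ → Ω → S} (he : ∀ s, Measurable (e s)) (m : ℕ) : Filtration ℕ m0 where
  seq n := pastSigma e (n - m)
  mono' := fun _ _ h => pastSigma_mono (by gcongr)
  le' _ := pastSigma_le he _

theorem stronglyMeasurable_proj {e : ℤ → Ω → S} (x : ℕ → Ω → ℝ) (m t : ℕ) :
    StronglyMeasurable[pastSigma e (t - m)] (proj μ e x m t) :=
  stronglyMeasurable_condExp.sub
    (stronglyMeasurable_condExp.mono (pastSigma_mono (by omega)))

theorem condExp_proj [IsProbabilityMeasure μ] {e : ℤ → Ω → S} (he : ∀ s, Measurable (e s))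
    (x : ℕ → Ω → ℝ) (m t : ℕ) :
    μ[proj μ e x m (t + 1) | pastSigma e (t - m)] =ᵐ[μ] 0 := by
  have hst : ((t + 1 : ℕ) : ℤ) - m - 1 = t - m := by push_cast; ring
  have h1 := condExp_sub (μ := μ) (integrable_condExp (m := pastSigma e ((t + 1 : ℕ) - m))
    (f := x (t + 1))) (integrable_condExp (m := pastSigma e ((t + 1 : ℕ) - m - 1))
    (f := x (t + 1))) (pastSigma e (t - m))
  have h2 := condExp_condExp_of_le (μ := μ) (f := x (t + 1))
    (pastSigma_mono (e := e) (by push_cast; omega : (t : ℤ) - m ≤ (t + 1 : ℕ) - m))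
    (pastSigma_le he _)
  have h3 : μ[μ[x (t + 1) | pastSigma e ((t + 1 : ℕ) - m - 1)] | pastSigma e (t - m)]
      = μ[x (t + 1) | pastSigma e (t - m)] := by
    rw [hst]
    exact condExp_of_stronglyMeasurable (pastSigma_le he _) stronglyMeasurable_condExp
      integrable_condExp
  filter_upwards [h1, h2] with ω h1 h2
  unfold proj
  rw [h1, Pi.sub_apply, h2, h3, sub_self, Pi.zero_apply]

/-- The `L^p` norm of a projection is at most the physical dependence measure. -/
theorem eLpNorm_proj_le_theta [IsProbabilityMeasure μ] (hε : IsInnovation μ ε ε') {i t : ℕ}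
    (hi : 1 ≤ i) (hg : Measurable (g i t)) (hint : Integrable (proc g ε i t) μ) {p : ℝ}
    (hp : 1 ≤ p) (m : ℕ) :
    eLpNorm (proj μ (ε i) (proc g ε i) m t) (ENNReal.ofReal p) μ ≤ theta μ g ε ε' p i t m := by
  have hp1 : 1 ≤ ENNReal.ofReal p := by simpa using hp
  have hc := condExp_coupled (hε.measurable i hi) (hε.measurable_copy i hi) (hε.indep i hi)
    (hε.copy_indep i hi) (hε.copy_identDistrib i hi) hg ((t : ℤ) - m) m
    (by rw [sub_add_cancel]; exact hint)
  rw [sub_add_cancel] at hc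
  have he : (fun ω => g i t (glue m (future (ε i) (t - m) ω)
      (consSeq (ε' i (t - m) ω) (past (ε i) (t - m - 1) ω)))) = coupled g ε ε' i t m := by
    ext ω; rw [coupled_eq_glue]
  rw [he] at hc
  obtain ⟨hci, hc⟩ := hc
  have h1 := condExp_sub hint hci (pastSigma (ε i) (t - m))
  have h2 : proj μ (ε i) (proc g ε i) m t
      =ᵐ[μ] μ[proc g ε i t - coupled g ε ε' i t m | pastSigma (ε i) (t - m)] := by
    filter_upwards [h1, hc] with ω h1 hc
    rw [h1]
    simp only [proj, Pi.sub_apply, hc]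
    rfl
  rw [eLpNorm_congr_ae h2]
  exact eLpNorm_condExp_le_eLpNorm _ hp1

/-- The projections telescope. -/
theorem sum_proj [IsProbabilityMeasure μ] (hε : IsInnovation μ ε ε') {i t : ℕ}
    (hi : 1 ≤ i) (hg : Measurable (g i t)) (hint : Integrable (proc g ε i t) μ) (K : ℕ) :
    ∑ m ∈ Finset.range K, proj μ (ε i) (proc g ε i) m t
      = proc g ε i t - μ[proc g ε i t | pastSigma (ε i) (t - K)] := by
  have hx : μ[proc g ε i t | pastSigma (ε i) t] = proc g ε i t := by
    refine condExp_of_stronglyMeasurable (pastSigma_le (hε.measurable i hi) _) ?_ hint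
    exact (hg.comp (comap_measurable (past (ε i) t))).stronglyMeasurable
  have h := Finset.sum_range_sub' (fun m : ℕ => μ[proc g ε i t | pastSigma (ε i) (t - m)]) K
  simp only [Nat.cast_zero, sub_zero, hx] at h
  rw [← h]
  refine Finset.sum_congr rfl fun m _ => ?_
  rw [proj]
  congr 3
  push_cast; ring_nf

theorem runMax_partialSum_le {D : ℕ → ℕ → Ω → ℝ} {x R : ℕ → Ω → ℝ} {K : ℕ}
    (h : ∀ t, 1 ≤ t → ∀ ω, x t ω = ∑ m ∈ Finset.range K, D m t ω + R t ω) (N : ℕ) (ω : Ω) :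
    runMax (partialSum x) N ω ≤ ∑ m ∈ Finset.range K, runMax (partialSum (D m)) N ω
      + ∑ t ∈ Finset.Icc 1 N, |R t ω| := by
  refine runMax_le fun n hn => ?_
  have h1 : partialSum x n ω = ∑ m ∈ Finset.range K, partialSum (D m) n ω
      + ∑ t ∈ Finset.Icc 1 n, R t ω := by
    simp only [partialSum]
    rw [Finset.sum_comm, ← Finset.sum_add_distrib]
    exact Finset.sum_congr rfl fun t ht => h t (Finset.mem_Icc.1 ht).1 ω
  rw [h1]
  refine (abs_add_le _ _).trans (add_le_add ?_ ?_)
  · exact (Finset.abs_sum_le_sum_abs _ _).trans (Finset.sum_le_sum fun m _ => le_runMax _ hn ω)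
  · refine (Finset.abs_sum_le_sum_abs _ _).trans
      (Finset.sum_le_sum_of_subset_of_nonneg ?_ fun _ _ _ => abs_nonneg _)
    exact Finset.Icc_subset_Icc_right hn

/-- The constant in the maximal moment inequality under physical dependence. -/
noncomputable def momentConst (p : ℝ) : ℝ≥0∞ :=
  ENNReal.ofReal (p / (p - 1)) * ENNReal.ofReal (4 * p) ^ (1 / min p 2)

theorem momentConst_ne_top {p : ℝ} (hp : 1 < p) : momentConst p ≠ ∞ := by
  have hs0 : 0 < min p 2 := lt_min (by linarith) (by norm_num)
  exact ENNReal.mul_ne_top (by simp) (ENNReal.rpow_ne_top_of_nonneg (by positivity) ENNReal.ofReal_ne_top)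

/-- Tail bound for the running maximum of the partial sums of one coordinate. Half of the
threshold is spent on the first `K` projections, bounded in `L^p`, and half on the remainder,
which is negligible in `L¹` as `K → ∞`. -/
theorem measure_le_runMax_le [IsProbabilityMeasure μ] (hε : IsInnovation μ ε ε') {i : ℕ}
    (hi : 1 ≤ i) (hg : ∀ t, 1 ≤ t → Measurable (g i t))
    (hint : ∀ t, 1 ≤ t → Integrable (proc g ε i t) μ)
    (hmean : ∀ t, 1 ≤ t → ∫ ω, proc g ε i t ω ∂μ = 0) {p : ℝ} (hp : 1 < p) {c ψ : ℕ → ℝ≥0}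
    (hθ : ∀ t m, 1 ≤ t → theta μ g ε ε' p i t m ≤ c t * ψ m) (N : ℕ) {r : ℝ} (hr : 0 < r) :
    μ {ω | r ≤ runMax (partialSum (proc g ε i)) N ω}
      ≤ ((ENNReal.ofReal (r / 2))⁻¹ * (momentConst p
        * (∑ t ∈ Finset.Icc 1 N, (c t : ℝ≥0∞) ^ (min p 2)) ^ (1 / min p 2)
        * ∑' m, (ψ m : ℝ≥0∞))) ^ p := by
  have he := hε.measurable i hi
  have hp0 : 0 < p := by linarith
  have hs0 : 0 < min p 2 := lt_min hp0 (by norm_num)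
  have hp1 : 1 ≤ ENNReal.ofReal p := by simpa using hp.le
  have hr2 : 0 < r / 2 := by positivity
  set D : ℕ → ℕ → Ω → ℝ := proj μ (ε i) (proc g ε i) with hD
  have hDle : ∀ m t, 1 ≤ t → eLpNorm (D m t) (ENNReal.ofReal p) μ ≤ c t * ψ m := fun m t ht =>
    (eLpNorm_proj_le_theta hε hi (hg t ht) (hint t ht) hp.le m).trans (hθ t m ht)
  have hDm : ∀ m t : ℕ, StronglyMeasurable[pastSigma (ε i) (t - m)] (D m t) := fun m t =>
    stronglyMeasurable_proj _ _ _
  have hDm' : ∀ m t, Measurable (D m t) := fun m t =>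
    ((hDm m t).mono (pastSigma_le he _)).measurable
  have hDp : ∀ m t, 1 ≤ t → MemLp (D m t) (ENNReal.ofReal p) μ := fun m t ht =>
    ⟨(hDm' m t).aestronglyMeasurable, (hDle m t ht).trans_lt
      (ENNReal.mul_lt_top ENNReal.coe_lt_top ENNReal.coe_lt_top)⟩
  have hMm : ∀ m n, Measurable (partialSum (D m) n) := fun m n =>
    Finset.measurable_fun_sum _ fun t _ => hDm' m t
  set B := momentConst p * (∑ t ∈ Finset.Icc 1 N, (c t : ℝ≥0∞) ^ (min p 2)) ^ (1 / min p 2)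
    * ∑' m, (ψ m : ℝ≥0∞) with hB
  have hM : ∀ m, eLpNorm (runMax (partialSum (D m)) N) (ENNReal.ofReal p) μ ≤ momentConst p
      * (∑ t ∈ Finset.Icc 1 N, (c t : ℝ≥0∞) ^ (min p 2)) ^ (1 / min p 2) * ψ m := by
    intro m
    refine (eLpNorm_runMax_partialSum_le (𝒢 := pastFiltration he m) hp (fun t _ => hDm m t)
      (hDp m) (fun t => condExp_proj he _ m t) (hDle m) N).trans (le_of_eq ?_)
    rw [ENNReal.mul_rpow_of_nonneg _ _ (by positivity), momentConst]
    ring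
  set Y : ℕ → Ω → ℝ := fun K ω => ∑ m ∈ Finset.range K, runMax (partialSum (D m)) N ω with hY
  set Z : ℕ → Ω → ℝ := fun K ω => ∑ t ∈ Finset.Icc 1 N,
    |(μ[proc g ε i t | pastSigma (ε i) (t - K)]) ω| with hZ
  have hYm : ∀ K, Measurable (Y K) := fun K =>
    Finset.measurable_fun_sum _ fun m _ => measurable_runMax (hMm m) N
  have hZm : ∀ K, AEStronglyMeasurable (Z K) μ := fun K =>
    Finset.aestronglyMeasurable_fun_sum _ fun t _ => integrable_condExp.abs.1
  have hYB : ∀ K, eLpNorm (Y K) (ENNReal.ofReal p) μ ≤ B := by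
    intro K
    have h1 : Y K = ∑ m ∈ Finset.range K, runMax (partialSum (D m)) N := by
      ext ω; simp [hY]
    rw [h1]
    refine (eLpNorm_sum_le (fun m _ => (measurable_runMax (hMm m) N).aestronglyMeasurable)
      hp1).trans ((Finset.sum_le_sum fun m _ => hM m).trans ?_)
    rw [← Finset.mul_sum]
    exact mul_le_mul_right (ENNReal.sum_le_tsum _) _
  have hbound : ∀ K, μ {ω | r ≤ runMax (partialSum (proc g ε i)) N ω}
      ≤ ((ENNReal.ofReal (r / 2))⁻¹ * B) ^ p
        + (ENNReal.ofReal (r / 2))⁻¹ * eLpNorm (Z K) 1 μ := by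
    intro K
    have hdec : ∀ t, 1 ≤ t → ∀ ω, proc g ε i t ω = ∑ m ∈ Finset.range K, D m t ω
        + (μ[proc g ε i t | pastSigma (ε i) (t - K)]) ω := by
      intro t ht ω
      have := congrFun (sum_proj hε hi (hg t ht) (hint t ht) K) ω
      rw [Finset.sum_apply, Pi.sub_apply] at this
      rw [hD, this]; ring
    have hsub : {ω | r ≤ runMax (partialSum (proc g ε i)) N ω}
        ⊆ {ω | ENNReal.ofReal (r / 2) ≤ ‖Y K ω‖ₑ} ∪ {ω | ENNReal.ofReal (r / 2) ≤ ‖Z K ω‖ₑ} := by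
      intro ω (hω : r ≤ _)
      have h1 := hω.trans (runMax_partialSum_le hdec N ω)
      change r ≤ Y K ω + Z K ω at h1
      simp only [Set.mem_union, Set.mem_ofPred_eq, Real.enorm_eq_ofReal_abs]
      rcases le_total (r / 2) (Y K ω) with h | h
      · exact Or.inl (ENNReal.ofReal_le_ofReal (h.trans (le_abs_self _)))
      · exact Or.inr (ENNReal.ofReal_le_ofReal ((by linarith : r / 2 ≤ Z K ω).trans (le_abs_self _)))
    refine (measure_mono hsub).trans ((measure_union_le _ _).trans (add_le_add ?_ ?_))
    · refine (meas_ge_le_mul_pow_eLpNorm_enorm μ (by simpa using hp0) ENNReal.ofReal_ne_top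
        (hYm K).aestronglyMeasurable (by simpa using hr2) (by simp)).trans ?_
      rw [ENNReal.toReal_ofReal hp0.le, ← ENNReal.mul_rpow_of_nonneg _ _ hp0.le]
      gcongr
      exact hYB K
    · simpa using meas_ge_le_mul_pow_eLpNorm_enorm μ one_ne_zero ENNReal.one_ne_top (hZm K)
        (ε := ENNReal.ofReal (r / 2)) (by simpa using hr2) (by simp)
  have hZ0 : Tendsto (fun K => eLpNorm (Z K) 1 μ) atTop (𝓝 0) := by
    have h1 : Tendsto (fun K : ℕ => ∑ t ∈ Finset.Icc 1 N,
        eLpNorm (μ[proc g ε i t | pastSigma (ε i) (t - K)]) 1 μ) atTop (𝓝 0) := by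
      have := tendsto_finsetSum (Finset.Icc 1 N) fun t ht =>
        tendsto_eLpNorm_condExp_remote_past he (hε.indep i hi) (hg t (Finset.mem_Icc.1 ht).1) t
          (hint t (Finset.mem_Icc.1 ht).1) (hmean t (Finset.mem_Icc.1 ht).1)
      rwa [Finset.sum_const_zero] at this
    refine tendsto_of_tendsto_of_tendsto_of_le_of_le tendsto_const_nhds h1 (fun _ => zero_le)
      fun K => ?_
    have h2 : Z K = ∑ t ∈ Finset.Icc 1 N,
        fun ω => ‖(μ[proc g ε i t | pastSigma (ε i) (t - K)]) ω‖ := by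
      ext ω; simp [hZ]
    rw [h2]
    refine (eLpNorm_sum_le (fun t _ => integrable_condExp.1.norm) le_rfl).trans (le_of_eq ?_)
    exact Finset.sum_congr rfl fun t _ => eLpNorm_norm _
  have hlim : Tendsto (fun K => ((ENNReal.ofReal (r / 2))⁻¹ * B) ^ p
        + (ENNReal.ofReal (r / 2))⁻¹ * eLpNorm (Z K) 1 μ) atTop
      (𝓝 (((ENNReal.ofReal (r / 2))⁻¹ * B) ^ p)) := by
    have hinv : (ENNReal.ofReal (r / 2))⁻¹ ≠ ∞ := ENNReal.inv_ne_top.2 (by simpa using hr2)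
    have := (ENNReal.Tendsto.const_mul hZ0 (Or.inr hinv)).const_add
      (((ENNReal.ofReal (r / 2))⁻¹ * B) ^ p)
    simpa using this
  exact ge_of_tendsto' hlim hbound

end

/-! ### Borel–Cantelli along dyadic blocks -/

section

theorem tsum_lt_top_of_eventually_le {a b : ℕ → ℝ≥0∞} (ha : ∀ l, a l ≠ ∞)
    (hab : ∀ᶠ l in atTop, a l ≤ b l) (hb : ∑' l, b l ≠ ∞) : ∑' l, a l ≠ ∞ := by
  obtain ⟨L, hL⟩ := eventually_atTop.1 hab
  rw [← ENNReal.summable.sum_add_tsum_nat_add' (f := a) (k := L)]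
  refine ENNReal.add_ne_top.2 ⟨ENNReal.sum_ne_top.2 fun l _ => ha l, ?_⟩
  refine ne_top_of_le_ne_top hb ((ENNReal.tsum_le_tsum fun l => hL (l + L) (by omega)).trans ?_)
  exact ENNReal.tsum_comp_le_tsum_of_injective (add_left_injective L) b

variable {Ω : Type*} {m0 : MeasurableSpace Ω} {μ : Measure Ω}

/-- Reduction to dyadic times: for `2^(l-1) < n ≤ 2^l` the mean at time `n` is at most twice the
running maximum at time `2^l` divided by `2^l`. -/
theorem ae_tendsto_maxMean {x : ℕ → ℕ → Ω → ℝ} {k : ℕ → ℕ} (hk : Monotone k)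
    (h : ∀ r : ℝ, 0 < r → ∑' l : ℕ, ∑ i ∈ Finset.Icc 1 (k (2 ^ l)),
      μ {ω | r * 2 ^ l ≤ runMax (partialSum (x i)) (2 ^ l) ω} ≠ ∞) :
    ∀ᵐ ω ∂μ, Tendsto (fun n => maxMean x k n ω) atTop (𝓝 0) := by
  have h1 : ∀ j : ℕ, ∀ᵐ ω ∂μ, ∀ᶠ l in atTop, ω ∉ ⋃ i ∈ Finset.Icc 1 (k (2 ^ l)),
      {ω | 1 / ((j : ℝ) + 1) * 2 ^ l ≤ runMax (partialSum (x i)) (2 ^ l) ω} := by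
    intro j
    refine ae_eventually_notMem (ne_top_of_le_ne_top (h (1 / ((j : ℝ) + 1)) (by positivity)) ?_)
    exact ENNReal.tsum_le_tsum fun l => measure_biUnion_finset_le _ _
  filter_upwards [ae_all_iff.2 h1] with ω hω
  rw [← NNReal.tendsto_coe, NNReal.coe_zero]
  refine Metric.tendsto_atTop.2 fun δ hδ => ?_
  obtain ⟨j, hj⟩ := exists_nat_one_div_lt (by positivity : 0 < δ / 2)
  obtain ⟨L, hL⟩ := eventually_atTop.1 (hω j)
  refine ⟨2 ^ L + 2, fun n hn => ?_⟩
  have hn2 : 1 < n := by have := Nat.one_le_two_pow (n := L); omega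
  have hnpos : (0 : ℝ) < n := by exact_mod_cast (by omega : 0 < n)
  set l := Nat.clog 2 n with hl
  have hnl : n ≤ 2 ^ l := Nat.le_pow_clog one_lt_two n
  have hLl : L ≤ l := by
    have : 2 ^ L ≤ 2 ^ l := by omega
    exact (Nat.pow_le_pow_iff_right one_lt_two).1 this
  have hl1 : 1 ≤ l := Nat.clog_pos one_lt_two hn2
  have h2l : (2 : ℝ) ^ l ≤ 2 * n := by
    have h3 : 2 ^ l.pred < n := Nat.pow_pred_clog_lt_self one_lt_two hn2
    have h4 : 2 ^ l = 2 * 2 ^ l.pred := by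
      rw [← pow_succ', ← Nat.succ_eq_add_one, Nat.succ_pred_eq_of_pos hl1]
    have h5 : 2 ^ l ≤ 2 * n := by omega
    exact_mod_cast h5
  have hnot := hL l hLl
  simp only [Set.mem_iUnion, not_exists, Set.mem_ofPred_eq, not_le] at hnot
  have hmax : maxMean x k n ω ≤ (2 * (1 / ((j : ℝ) + 1))).toNNReal := by
    refine Finset.sup_le fun i hi => ?_
    have hi' : i ∈ Finset.Icc 1 (k (2 ^ l)) :=
      Finset.Icc_subset_Icc_right (hk hnl) hi
    have h6 := (le_runMax (partialSum (x i)) hnl ω).trans (hnot i hi').le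
    refine NNReal.coe_le_coe.1 ?_
    rw [coe_nnnorm, Real.coe_toNNReal _ (by positivity), norm_mul, Real.norm_eq_abs,
      Real.norm_eq_abs, abs_of_nonneg (by positivity), one_div_mul_eq_div, div_le_iff₀ hnpos]
    calc |partialSum (x i) n ω| ≤ 1 / ((j : ℝ) + 1) * 2 ^ l := h6
      _ ≤ 1 / ((j : ℝ) + 1) * (2 * n) := by gcongr
      _ = _ := by ring
  have h7 : (maxMean x k n ω : ℝ) ≤ 2 * (1 / ((j : ℝ) + 1)) := by
    have := NNReal.coe_le_coe.2 hmax
    rwa [Real.coe_toNNReal _ (by positivity)] at this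
  rw [dist_zero_right, NNReal.norm_eq]
  linarith

/-- The coefficients `ψ_{i,m} ≤ C (m ∨ 1)^{-λ-ι}` are summable, uniformly in `i`. -/
theorem exists_tsum_le {ψ : ℕ → ℕ → ℝ≥0} {lam : ℝ} (hlam : 1 ≤ lam)
    (hψ : ∃ ι > (0 : ℝ), ∃ C : ℝ, ∀ i m : ℕ, 1 ≤ i →
      (ψ i m : ℝ) ≤ C * ((max m 1 : ℕ) : ℝ) ^ (-lam - ι)) :
    ∃ Ψ : ℝ≥0∞, Ψ ≠ ∞ ∧ ∀ i, 1 ≤ i → ∑' m, (ψ i m : ℝ≥0∞) ≤ Ψ := by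
  obtain ⟨ι, hι, C, hC⟩ := hψ
  refine ⟨∑' m : ℕ, ENNReal.ofReal (C * ((max m 1 : ℕ) : ℝ) ^ (-lam - ι)), ?_, fun i hi =>
    ENNReal.tsum_le_tsum fun m => ?_⟩
  · have hs : Summable fun m : ℕ => ((max m 1 : ℕ) : ℝ) ^ (-lam - ι) := by
      rw [← summable_nat_add_iff 1]
      have h1 := (summable_nat_add_iff 1).2
        (Real.summable_nat_rpow.2 (by linarith : -lam - ι < -1))
      refine h1.congr fun m => ?_
      rw [max_eq_left (by omega)]
    exact (hs.mul_left C).tsum_ofReal_ne_top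
  · rw [← ENNReal.ofReal_coe_nnreal]
    exact ENNReal.ofReal_le_ofReal (hC i m hi)

end

/-! ### Union bounds over the coordinates -/

section

variable {Ω S : Type*} [mS : MeasurableSpace S] {m0 : MeasurableSpace Ω} {μ : Measure Ω}
  {ε ε' : ℕ → ℤ → Ω → S} {g : ℕ → ℕ → (ℕ → S) → ℝ}

/-- Union bound over the coordinates `i ≤ k`, with `V` a common bound of `∑_{t ≤ N} d_{i,t}^p'`. -/
theorem sum_measure_le_runMax_le [IsProbabilityMeasure μ] (hε : IsInnovation μ ε ε')
    (hg : ∀ i t : ℕ, 1 ≤ i → 1 ≤ t → Measurable (g i t))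
    (hint : ∀ i t : ℕ, 1 ≤ i → 1 ≤ t → Integrable (proc g ε i t) μ)
    (hmean : ∀ i t : ℕ, 1 ≤ i → 1 ≤ t → ∫ ω, proc g ε i t ω ∂μ = 0)
    {p : ℝ} (hp : 1 < p) {d ψ : ℕ → ℕ → ℝ≥0}
    (hθ : ∀ i t m : ℕ, 1 ≤ i → 1 ≤ t → theta μ g ε ε' p i t m ≤ d i t * ψ i m)
    {Ψ : ℝ≥0∞} (hΨ : ∀ i, 1 ≤ i → ∑' m, (ψ i m : ℝ≥0∞) ≤ Ψ) {k N : ℕ} (hN : N ≠ 0) {V : ℝ≥0∞}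
    (hV : ∀ i ∈ Finset.Icc 1 k, ∑ t ∈ Finset.Icc 1 N, (d i t : ℝ≥0∞) ^ (min p 2) ≤ V)
    {r : ℝ} (hr : 0 < r) :
    ∑ i ∈ Finset.Icc 1 k, μ {ω | r * N ≤ runMax (partialSum (proc g ε i)) N ω}
      ≤ ((ENNReal.ofReal (r / 2))⁻¹ * (momentConst p * Ψ)) ^ p
        * (k * ((N : ℝ≥0∞) ^ (-p) * V ^ (p / min p 2))) := by
  have hp0 : 0 < p := by linarith
  have hs0 : 0 < min p 2 := lt_min hp0 (by norm_num)
  have hNr : (0 : ℝ) < N := by exact_mod_cast Nat.pos_of_ne_zero hN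
  have hterm : ∀ i ∈ Finset.Icc 1 k, μ {ω | r * N ≤ runMax (partialSum (proc g ε i)) N ω}
      ≤ ((ENNReal.ofReal (r / 2))⁻¹ * (momentConst p * Ψ)) ^ p
        * ((N : ℝ≥0∞) ^ (-p) * V ^ (p / min p 2)) := by
    intro i hi
    have hi1 := (Finset.mem_Icc.1 hi).1
    refine (measure_le_runMax_le hε hi1 (fun t => hg i t hi1) (fun t => hint i t hi1)
      (fun t => hmean i t hi1) hp (fun t m => hθ i t m hi1) N (by positivity)).trans ?_
    have h1 : (ENNReal.ofReal (r * N / 2))⁻¹ = (ENNReal.ofReal (r / 2))⁻¹ * (N : ℝ≥0∞)⁻¹ := by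
      rw [show r * N / 2 = r / 2 * N by ring, ENNReal.ofReal_mul (by positivity),
        ENNReal.ofReal_natCast, ENNReal.mul_inv (Or.inr (by simp)) (Or.inl (by simp))]
    have h2 : V ^ (p / min p 2) = (V ^ (1 / min p 2)) ^ p := by
      rw [← ENNReal.rpow_mul]; congr 1; ring
    rw [h1, h2, ENNReal.rpow_neg, ← ENNReal.inv_rpow, ← ENNReal.mul_rpow_of_nonneg _ _ hp0.le,
      ← ENNReal.mul_rpow_of_nonneg _ _ hp0.le]
    refine ENNReal.rpow_le_rpow ?_ hp0.le
    calc _ ≤ (ENNReal.ofReal (r / 2))⁻¹ * (N : ℝ≥0∞)⁻¹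
          * (momentConst p * V ^ (1 / min p 2) * Ψ) := by
          gcongr
          · exact hV i hi
          · exact hΨ i hi1
      _ = _ := by ring
  refine (Finset.sum_le_card_nsmul _ _ _ hterm).trans (le_of_eq ?_)
  rw [Nat.card_Icc, Nat.add_sub_cancel, nsmul_eq_mul]
  ring

theorem ae_tendsto_maxMean_of_tsum [IsProbabilityMeasure μ] (hε : IsInnovation μ ε ε')
    (hg : ∀ i t : ℕ, 1 ≤ i → 1 ≤ t → Measurable (g i t))
    (hint : ∀ i t : ℕ, 1 ≤ i → 1 ≤ t → Integrable (proc g ε i t) μ)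
    (hmean : ∀ i t : ℕ, 1 ≤ i → 1 ≤ t → ∫ ω, proc g ε i t ω ∂μ = 0)
    {k : ℕ → ℕ} (hk : Monotone k) {p : ℝ} (hp : 1 < p) {d ψ : ℕ → ℕ → ℝ≥0}
    (hθ : ∀ i t m : ℕ, 1 ≤ i → 1 ≤ t → theta μ g ε ε' p i t m ≤ d i t * ψ i m)
    {Ψ : ℝ≥0∞} (hΨt : Ψ ≠ ∞) (hΨ : ∀ i, 1 ≤ i → ∑' m, (ψ i m : ℝ≥0∞) ≤ Ψ) {V b : ℕ → ℝ≥0∞}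
    (hV : ∀ l, ∀ i ∈ Finset.Icc 1 (k (2 ^ l)),
      ∑ t ∈ Finset.Icc 1 (2 ^ l), (d i t : ℝ≥0∞) ^ (min p 2) ≤ V l)
    (hb : ∀ᶠ l in atTop, k (2 ^ l) * (((2 ^ l : ℕ) : ℝ≥0∞) ^ (-p) * V l ^ (p / min p 2)) ≤ b l)
    (hbs : ∑' l, b l ≠ ∞) :
    ∀ᵐ ω ∂μ, Tendsto (fun n => maxMean (proc g ε) k n ω) atTop (𝓝 0) := by
  refine ae_tendsto_maxMean hk fun r hr => ?_
  set C := ((ENNReal.ofReal (r / 2))⁻¹ * (momentConst p * Ψ)) ^ p with hC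
  have hCt : C ≠ ∞ := by
    refine ENNReal.rpow_ne_top_of_nonneg (by linarith) (ENNReal.mul_ne_top ?_
      (ENNReal.mul_ne_top (momentConst_ne_top hp) hΨt))
    exact ENNReal.inv_ne_top.2 (by simpa using hr)
  refine tsum_lt_top_of_eventually_le (b := fun l => C * b l)
    (fun l => ENNReal.sum_ne_top.2 fun i _ => measure_ne_top _ _) ?_ ?_
  · filter_upwards [hb] with l hl
    have := sum_measure_le_runMax_le hε hg hint hmean hp hθ hΨ (N := 2 ^ l) (by positivity)
      (hV l) hr
    push_cast at this
    refine this.trans (mul_le_mul_right ?_ _)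
    exact_mod_cast hl
  · rw [ENNReal.tsum_mul_left]
    exact ENNReal.mul_ne_top hCt hbs

end

/-! ### Sums along powers of two -/

section

theorem tsum_two_pow_rpow_ne_top {δ : ℝ} (hδ : 0 < δ) :
    ∑' l : ℕ, ((2 ^ l : ℕ) : ℝ≥0∞) ^ (-δ) ≠ ∞ := by
  have h : ∀ l : ℕ, ((2 ^ l : ℕ) : ℝ≥0∞) ^ (-δ) = ((2 : ℝ≥0∞) ^ (-δ)) ^ l := by
    intro l
    rw [← ENNReal.rpow_natCast ((2 : ℝ≥0∞) ^ (-δ)), ← ENNReal.rpow_mul, mul_comm (-δ),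
      ENNReal.rpow_mul, ENNReal.rpow_natCast]
    push_cast; rfl
  simp_rw [h]
  rw [ENNReal.tsum_geometric]
  refine ENNReal.inv_ne_top.2 (tsub_pos_of_lt ?_).ne'
  exact ENNReal.rpow_lt_one_of_one_lt_of_neg ENNReal.one_lt_two (by linarith)

/-- `∑_{l : 2^l ≥ t} (t / 2^l)^β` is bounded uniformly in `t`. -/
theorem tsum_ite_le_two_pow_le {β : ℝ} (hβ : 0 < β) (t : ℕ) :
    ∑' l : ℕ, (if t ≤ 2 ^ l then (t : ℝ≥0∞) ^ β * ((2 ^ l : ℕ) : ℝ≥0∞) ^ (-β) else 0)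
      ≤ ∑' l : ℕ, ((2 ^ l : ℕ) : ℝ≥0∞) ^ (-β) := by
  set L := Nat.clog 2 t with hL
  rw [← ENNReal.summable.sum_add_tsum_nat_add' (k := L)]
  rw [Finset.sum_eq_zero, zero_add]
  · refine ENNReal.tsum_le_tsum fun l => ?_
    split_ifs with h
    · have ht : t ≤ 2 ^ L := Nat.le_pow_clog one_lt_two t
      have h1 : (t : ℝ≥0∞) ≤ ((2 ^ L : ℕ) : ℝ≥0∞) := by exact_mod_cast ht
      rw [pow_add, Nat.cast_mul, ENNReal.mul_rpow_of_ne_top (by simp) (by simp), mul_comm, mul_assoc]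
      refine mul_le_of_le_one_right' ?_
      calc _ ≤ ((2 ^ L : ℕ) : ℝ≥0∞) ^ (-β) * ((2 ^ L : ℕ) : ℝ≥0∞) ^ β := by gcongr
        _ = 1 := by
          rw [← ENNReal.rpow_add _ _ (by simp) (by simp), neg_add_cancel, ENNReal.rpow_zero]
    · exact zero_le
  · intro l hl
    have h1 : ¬ t ≤ 2 ^ l := by
      intro h
      exact absurd ((Nat.clog_le_iff_le_pow one_lt_two).2 h) (not_le.2 (Finset.mem_range.1 hl))
    rw [if_neg h1]

/-- A Kronecker-type summation: averages of a summable sequence with weights `(t/N)^β` are summable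
along `N = 2^l`. -/
theorem tsum_weighted_average_ne_top {β : ℝ} (hβ : 0 < β) {D : ℕ → ℝ≥0∞}
    (hD : ∑' t, D (t + 1) ≠ ∞) :
    ∑' l : ℕ, ((2 ^ l : ℕ) : ℝ≥0∞) ^ (-β)
      * ∑ t ∈ Finset.Icc (1 : ℕ) (2 ^ l), (t : ℝ≥0∞) ^ β * D t ≠ ∞ := by
  have h1 : ∀ l : ℕ, ((2 ^ l : ℕ) : ℝ≥0∞) ^ (-β)
      * ∑ t ∈ Finset.Icc (1 : ℕ) (2 ^ l), (t : ℝ≥0∞) ^ β * D t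
      ≤ ∑' t : ℕ, (if t + 1 ≤ 2 ^ l then ((t + 1 : ℕ) : ℝ≥0∞) ^ β
        * ((2 ^ l : ℕ) : ℝ≥0∞) ^ (-β) else 0) * D (t + 1) := by
    intro l
    have hI : Finset.Icc 1 (2 ^ l) = Finset.Ico (0 + 1) (2 ^ l + 1) := by
      ext t; simp only [Finset.mem_Icc, Finset.mem_Ico]; omega
    rw [hI, ← Finset.sum_Ico_add' (fun t : ℕ => (t : ℝ≥0∞) ^ β * D t) 0 (2 ^ l) 1,
      Finset.mul_sum]
    refine le_trans (Finset.sum_le_sum fun t ht => ?_) (ENNReal.sum_le_tsum (Finset.Ico 0 (2 ^ l)))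
    rw [if_pos (by have := (Finset.mem_Ico.1 ht).2; omega)]
    exact le_of_eq (by ring)
  refine ne_top_of_le_ne_top ?_ (ENNReal.tsum_le_tsum h1)
  rw [ENNReal.tsum_comm]
  simp_rw [ENNReal.tsum_mul_right]
  refine ne_top_of_le_ne_top ?_ (ENNReal.tsum_le_tsum fun t =>
    mul_le_mul_left (tsum_ite_le_two_pow_le hβ (t + 1)) _)
  rw [ENNReal.tsum_mul_left]
  exact ENNReal.mul_ne_top (tsum_two_pow_rpow_ne_top hβ) hD

end

/-! ### Polynomially many coordinates -/

section

section Moments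

variable {Ω : Type*} {m0 : MeasurableSpace Ω} {μ : Measure Ω} {x : ℕ → ℕ → Ω → ℝ} {k : ℕ → ℕ}

theorem lintegral_le_maxMoment {p : ℝ} {n i t : ℕ} (hi : i ∈ Finset.Icc 1 (k n))
    (ht : t ∈ Finset.Icc 1 n) : ∫⁻ ω, ‖x i t ω‖ₑ ^ p ∂μ ≤ maxMoment μ x k p n :=
  (Finset.le_sup (f := fun t => ∫⁻ ω, ‖x i t ω‖ₑ ^ p ∂μ) ht).trans
    (Finset.le_sup (f := fun i => (Finset.Icc 1 n).sup fun t => ∫⁻ ω, ‖x i t ω‖ₑ ^ p ∂μ) hi)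

theorem maxMoment_mono (hk : Monotone k) (p : ℝ) : Monotone (maxMoment μ x k p) := by
  intro n m hnm
  refine Finset.sup_le fun i hi => Finset.sup_le fun t ht => lintegral_le_maxMoment ?_ ?_
  · exact Finset.Icc_subset_Icc_right (hk hnm) hi
  · exact Finset.Icc_subset_Icc_right hnm ht

theorem eventually_mul_maxMoment_le {p b : ℝ}
    (h : Tendsto (fun n : ℕ => (k n : ℝ≥0∞) * maxMoment μ x k p n / (n : ℝ≥0∞) ^ (p * (1 - b)))
      atTop (𝓝 0)) :
    ∀ᶠ n : ℕ in atTop, (k n : ℝ≥0∞) * maxMoment μ x k p n ≤ (n : ℝ≥0∞) ^ (p * (1 - b)) := by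
  filter_upwards [h.eventually (gt_mem_nhds one_pos), eventually_gt_atTop 0] with n hn hn0
  have hn' : (n : ℝ≥0∞) ≠ 0 := by exact_mod_cast hn0.ne'
  have h0 : (n : ℝ≥0∞) ^ (p * (1 - b)) ≠ 0 := by simp [ENNReal.rpow_eq_zero_iff, hn']
  have ht : (n : ℝ≥0∞) ^ (p * (1 - b)) ≠ ∞ := by simp [ENNReal.rpow_eq_top_iff, hn']
  have := (ENNReal.div_le_iff h0 ht).1 hn.le
  rwa [one_mul] at this

/-- Unless all moments vanish, the moment condition bounds the growth of `k`. -/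
theorem exists_eventually_le_of_maxMoment_ne_zero (hk : Monotone k) {p b : ℝ} {n₀ : ℕ}
    (hn₀ : maxMoment μ x k p n₀ ≠ 0)
    (h : ∀ᶠ n : ℕ in atTop, (k n : ℝ≥0∞) * maxMoment μ x k p n ≤ (n : ℝ≥0∞) ^ (p * (1 - b))) :
    ∃ c : ℝ≥0∞, c ≠ ∞ ∧ ∀ᶠ n : ℕ in atTop, (k n : ℝ≥0∞) ≤ c * (n : ℝ≥0∞) ^ (p * (1 - b)) := by
  set a := min (maxMoment μ x k p n₀) 1 with ha
  have ha0 : a ≠ 0 := by simp [ha, hn₀]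
  have hat : a ≠ ∞ := ne_top_of_le_ne_top ENNReal.one_ne_top (min_le_right _ _)
  refine ⟨a⁻¹, ENNReal.inv_ne_top.2 ha0, ?_⟩
  filter_upwards [h, eventually_ge_atTop n₀] with n hn hnn
  rw [mul_comm, ← div_eq_mul_inv, ENNReal.le_div_iff_mul_le (Or.inl ha0) (Or.inl hat)]
  refine le_trans ?_ hn
  gcongr
  exact (min_le_left _ _).trans (maxMoment_mono hk p hnn)

theorem ae_tendsto_maxMean_of_maxMoment_eq_zero (hk : Monotone k) {p : ℝ} (hp : 0 < p)
    (hint : ∀ i t : ℕ, 1 ≤ i → 1 ≤ t → Integrable (x i t) μ)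
    (h : ∀ n, maxMoment μ x k p n = 0) :
    ∀ᵐ ω ∂μ, Tendsto (fun n => maxMean x k n ω) atTop (𝓝 0) := by
  refine ae_tendsto_maxMean hk fun r hr => ?_
  refine ne_of_eq_of_ne ?_ ENNReal.zero_ne_top
  refine ENNReal.tsum_eq_zero.2 fun l => Finset.sum_eq_zero fun i hi => ?_
  rw [measure_eq_zero_iff_ae_notMem]
  have hx : ∀ t ∈ Finset.Icc 1 (2 ^ l), ∀ᵐ ω ∂μ, x i t ω = 0 := by
    intro t ht
    have h1 : ∫⁻ ω, ‖x i t ω‖ₑ ^ p ∂μ = 0 :=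
      le_antisymm ((lintegral_le_maxMoment hi ht).trans (h _).le) zero_le
    rw [lintegral_eq_zero_iff'
      ((hint i t (Finset.mem_Icc.1 hi).1 (Finset.mem_Icc.1 ht).1).1.enorm.pow_const _)] at h1
    filter_upwards [h1] with ω hω
    simpa [ENNReal.rpow_eq_zero_iff, hp, hp.not_gt] using hω
  filter_upwards [(ae_ball_iff (Finset.Icc 1 (2 ^ l)).countable_toSet).2 hx] with ω hω
  rw [not_le]
  refine lt_of_le_of_lt (runMax_le (c := 0) fun n hn => ?_) (by positivity)
  rw [partialSum, Finset.sum_eq_zero, abs_zero]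
  exact fun t ht => hω t (Finset.Icc_subset_Icc_right hn ht)

end Moments

/-- Monotone convergence for the weighted sums. -/
theorem tsum_iSup_weightedSum_le {d : ℕ → ℕ → ℝ≥0} {k : ℕ → ℕ} (hk : Monotone k) (p b : ℝ) :
    ∑' s : ℕ, ⨆ n, (Finset.Icc 1 (k n)).sup (fun i =>
      ((d i (s + 1) : ℝ≥0∞) / ((s + 1 : ℕ) : ℝ≥0∞) ^ b) ^ (min p 2))
      ≤ ⨆ n, weightedSum d k p b n := by
  refine ENNReal.summable.tsum_le_of_sum_le fun s => ?_
  rw [ENNReal.finsetSum_iSup_of_monotone]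
  · exact iSup_mono fun n => ENNReal.sum_le_tsum s
  · exact fun s n m hnm => Finset.sup_mono (Finset.Icc_subset_Icc_right (hk hnm))

variable {Ω S : Type*} [mS : MeasurableSpace S] {m0 : MeasurableSpace Ω} {μ : Measure Ω}
  {ε ε' : ℕ → ℤ → Ω → S} {g : ℕ → ℕ → (ℕ → S) → ℝ}

/-- Convergence when the weighted sums are bounded. -/
theorem ae_tendsto_maxMean_of_weightedSum [IsProbabilityMeasure μ] (hε : IsInnovation μ ε ε')
    (hg : ∀ i t : ℕ, 1 ≤ i → 1 ≤ t → Measurable (g i t))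
    (hint : ∀ i t : ℕ, 1 ≤ i → 1 ≤ t → Integrable (proc g ε i t) μ)
    (hmean : ∀ i t : ℕ, 1 ≤ i → 1 ≤ t → ∫ ω, proc g ε i t ω ∂μ = 0)
    {k : ℕ → ℕ} (hk : Monotone k) {p : ℝ} (hp : 1 < p) {d ψ : ℕ → ℕ → ℝ≥0}
    (hθ : ∀ i t m : ℕ, 1 ≤ i → 1 ≤ t → theta μ g ε ε' p i t m ≤ d i t * ψ i m)
    {Ψ : ℝ≥0∞} (hΨt : Ψ ≠ ∞) (hΨ : ∀ i, 1 ≤ i → ∑' m, (ψ i m : ℝ≥0∞) ≤ Ψ) {b : ℝ} (hb : 0 < b)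
    (hd : (⨆ n : ℕ, weightedSum d k p b n) < ∞)
    (hlim : Tendsto (fun n : ℕ => (k n : ℝ≥0∞) * maxMoment μ (proc g ε) k p n
      / (n : ℝ≥0∞) ^ (p * (1 - b))) atTop (𝓝 0)) :
    ∀ᵐ ω ∂μ, Tendsto (fun n => maxMean (proc g ε) k n ω) atTop (𝓝 0) := by
  have hp0 : 0 < p := by linarith
  by_cases hzero : ∀ n, maxMoment μ (proc g ε) k p n = 0
  · exact ae_tendsto_maxMean_of_maxMoment_eq_zero hk hp0 hint hzero
  push Not at hzero
  obtain ⟨n₀, hn₀⟩ := hzero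
  obtain ⟨c, hct, hc⟩ := exists_eventually_le_of_maxMoment_ne_zero hk hn₀
    (eventually_mul_maxMoment_le hlim)
  set s := min p 2 with hs
  have hs0 : 0 < s := lt_min hp0 (by norm_num)
  have hρ : 0 ≤ p / s - 1 := by
    rw [sub_nonneg, le_div_iff₀ hs0, one_mul]; exact min_le_left _ _
  set β := b * s with hβdef
  have hβ : 0 < β := by positivity
  -- `D t` is the supremum of `(d_{i,t} / t^b)^p'` over all coordinates that ever occur.
  set D : ℕ → ℝ≥0∞ := fun t => ⨆ n, (Finset.Icc 1 (k n)).sup (fun i =>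
    ((d i t : ℝ≥0∞) / (t : ℝ≥0∞) ^ b) ^ s) with hD
  have hDt : ∑' t, D (t + 1) ≠ ∞ := ((tsum_iSup_weightedSum_le hk p b).trans_lt hd).ne
  set V : ℕ → ℝ≥0∞ := fun l => ∑ t ∈ Finset.Icc (1 : ℕ) (2 ^ l), (t : ℝ≥0∞) ^ β * D t with hV
  set W : ℕ → ℝ≥0∞ := fun l => ((2 ^ l : ℕ) : ℝ≥0∞) ^ (-β) * V l with hW
  have hWt : ∑' l, W l ≠ ∞ := tsum_weighted_average_ne_top hβ hDt
  set T := ∑' l, W l with hT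
  refine ae_tendsto_maxMean_of_tsum hε hg hint hmean hk hp hθ hΨt hΨ (V := V)
    (b := fun l => c * (T ^ (p / s - 1) * W l)) ?_ ?_ ?_
  · intro l i hi
    refine Finset.sum_le_sum fun t ht => ?_
    have ht0 : (t : ℝ≥0∞) ≠ 0 := by
      have := (Finset.mem_Icc.1 ht).1
      exact_mod_cast (by omega : t ≠ 0)
    have htb0 : (t : ℝ≥0∞) ^ b ≠ 0 := by simp [ENNReal.rpow_eq_zero_iff, ht0]
    have htbt : (t : ℝ≥0∞) ^ b ≠ ∞ := ENNReal.rpow_ne_top_of_nonneg hb.le (by simp)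
    calc (d i t : ℝ≥0∞) ^ s = ((t : ℝ≥0∞) ^ b * (d i t / (t : ℝ≥0∞) ^ b)) ^ s := by
          rw [ENNReal.mul_div_cancel htb0 htbt]
      _ = (t : ℝ≥0∞) ^ β * ((d i t : ℝ≥0∞) / (t : ℝ≥0∞) ^ b) ^ s := by
          rw [ENNReal.mul_rpow_of_nonneg _ _ hs0.le, ← ENNReal.rpow_mul]
      _ ≤ _ := by
          gcongr
          exact (Finset.le_sup (f := fun i => ((d i t : ℝ≥0∞) / (t : ℝ≥0∞) ^ b) ^ s) hi).trans
            (le_iSup (fun n => (Finset.Icc 1 (k n)).sup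
              fun i => ((d i t : ℝ≥0∞) / (t : ℝ≥0∞) ^ b) ^ s) (2 ^ l))
  · have h2 : Tendsto (fun l : ℕ => 2 ^ l) atTop atTop :=
      tendsto_pow_atTop_atTop_of_one_lt one_lt_two
    filter_upwards [h2.eventually hc] with l hl
    have hN0 : ((2 ^ l : ℕ) : ℝ≥0∞) ≠ 0 := by simp
    have hNt : ((2 ^ l : ℕ) : ℝ≥0∞) ≠ ∞ := ENNReal.natCast_ne_top _
    -- As `W l ≤ T` and `p / s ≥ 1`, the power `p / s` of `W l` is dominated by a multiple of `W l`.
    have h3 : W l ^ (p / s) ≤ T ^ (p / s - 1) * W l := by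
      calc W l ^ (p / s) = W l ^ (p / s - 1) * W l := by
            conv_rhs => rw [← ENNReal.rpow_one (W l), ← ENNReal.rpow_mul, one_mul]
            rw [← ENNReal.rpow_add_of_nonneg _ _ hρ zero_le_one, sub_add_cancel]
        _ ≤ _ := by gcongr; exact ENNReal.le_tsum l
    have h4 : ((2 ^ l : ℕ) : ℝ≥0∞) ^ (p * (1 - b)) * ((2 ^ l : ℕ) : ℝ≥0∞) ^ (-p)
        = (((2 ^ l : ℕ) : ℝ≥0∞) ^ (-β)) ^ (p / s) := by
      rw [← ENNReal.rpow_add _ _ hN0 hNt, ← ENNReal.rpow_mul]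
      congr 1
      rw [hβdef]; field_simp; ring
    calc (k (2 ^ l) : ℝ≥0∞) * (((2 ^ l : ℕ) : ℝ≥0∞) ^ (-p) * V l ^ (p / s))
        ≤ c * ((2 ^ l : ℕ) : ℝ≥0∞) ^ (p * (1 - b))
          * (((2 ^ l : ℕ) : ℝ≥0∞) ^ (-p) * V l ^ (p / s)) := by gcongr
      _ = c * ((((2 ^ l : ℕ) : ℝ≥0∞) ^ (p * (1 - b)) * ((2 ^ l : ℕ) : ℝ≥0∞) ^ (-p))
          * V l ^ (p / s)) := by ring
      _ = c * W l ^ (p / s) := by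
          rw [h4, hW, ENNReal.mul_rpow_of_nonneg _ _ (by positivity)]
      _ ≤ _ := by gcongr
  · rw [ENNReal.tsum_mul_left, ENNReal.tsum_mul_left]
    exact ENNReal.mul_ne_top hct (ENNReal.mul_ne_top (ENNReal.rpow_ne_top_of_nonneg hρ hWt) hWt)

/-- Convergence when `d_{i,t} ≤ 2 ‖x_{i,t}‖_p`: the moment condition then bounds the number of
coordinates and the coefficients at once. -/
theorem ae_tendsto_maxMean_of_le_eLpNorm [IsProbabilityMeasure μ] (hε : IsInnovation μ ε ε')
    (hg : ∀ i t : ℕ, 1 ≤ i → 1 ≤ t → Measurable (g i t))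
    (hint : ∀ i t : ℕ, 1 ≤ i → 1 ≤ t → Integrable (proc g ε i t) μ)
    (hmean : ∀ i t : ℕ, 1 ≤ i → 1 ≤ t → ∫ ω, proc g ε i t ω ∂μ = 0)
    {k : ℕ → ℕ} (hk : Monotone k) {p : ℝ} (hp : 1 < p) {d ψ : ℕ → ℕ → ℝ≥0}
    (hθ : ∀ i t m : ℕ, 1 ≤ i → 1 ≤ t → theta μ g ε ε' p i t m ≤ d i t * ψ i m)
    {Ψ : ℝ≥0∞} (hΨt : Ψ ≠ ∞) (hΨ : ∀ i, 1 ≤ i → ∑' m, (ψ i m : ℝ≥0∞) ≤ Ψ) {b : ℝ}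
    (hb : 1 / min p 2 < b)
    (hd : ∀ i t : ℕ, 1 ≤ i → 1 ≤ t →
      (d i t : ℝ≥0∞) ≤ 2 * eLpNorm (proc g ε i t) (ENNReal.ofReal p) μ)
    (hlim : Tendsto (fun n : ℕ => (k n : ℝ≥0∞) * maxMoment μ (proc g ε) k p n
      / (n : ℝ≥0∞) ^ (p * (1 - b))) atTop (𝓝 0)) :
    ∀ᵐ ω ∂μ, Tendsto (fun n => maxMean (proc g ε) k n ω) atTop (𝓝 0) := by
  have hp0 : 0 < p := by linarith
  set s := min p 2 with hs
  have hs0 : 0 < s := lt_min hp0 (by norm_num)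
  have hδ : 0 < p * (b - 1 / s) := mul_pos hp0 (by linarith)
  set M : ℕ → ℝ≥0∞ := fun l => maxMoment μ (proc g ε) k p (2 ^ l) with hM
  refine ae_tendsto_maxMean_of_tsum hε hg hint hmean hk hp hθ hΨt hΨ
    (V := fun l => ((2 ^ l : ℕ) : ℝ≥0∞) * (2 ^ p * M l) ^ (s / p))
    (b := fun l => 2 ^ p * ((2 ^ l : ℕ) : ℝ≥0∞) ^ (-(p * (b - 1 / s)))) ?_ ?_ ?_
  · intro l i hi
    have hterm : ∀ t ∈ Finset.Icc 1 (2 ^ l), (d i t : ℝ≥0∞) ^ s ≤ (2 ^ p * M l) ^ (s / p) := by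
      intro t ht
      calc (d i t : ℝ≥0∞) ^ s = ((d i t : ℝ≥0∞) ^ p) ^ (s / p) := by
            rw [← ENNReal.rpow_mul]; congr 1; field_simp
        _ ≤ ((2 * eLpNorm (proc g ε i t) (ENNReal.ofReal p) μ) ^ p) ^ (s / p) := by
            gcongr; exact hd i t (Finset.mem_Icc.1 hi).1 (Finset.mem_Icc.1 ht).1
        _ ≤ _ := by
            rw [ENNReal.mul_rpow_of_nonneg _ _ hp0.le, eLpNorm_ofReal_rpow hp0]
            gcongr
            exact lintegral_le_maxMoment hi ht
    refine (Finset.sum_le_card_nsmul _ _ _ hterm).trans (le_of_eq ?_)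
    rw [Nat.card_Icc, Nat.add_sub_cancel, nsmul_eq_mul]
  · have h2 : Tendsto (fun l : ℕ => 2 ^ l) atTop atTop :=
      tendsto_pow_atTop_atTop_of_one_lt one_lt_two
    filter_upwards [h2.eventually (eventually_mul_maxMoment_le hlim)] with l hl
    have hN0 : ((2 ^ l : ℕ) : ℝ≥0∞) ≠ 0 := by simp
    have hNt : ((2 ^ l : ℕ) : ℝ≥0∞) ≠ ∞ := ENNReal.natCast_ne_top _
    set N : ℝ≥0∞ := ((2 ^ l : ℕ) : ℝ≥0∞) with hN
    have h3 : (N * (2 ^ p * M l) ^ (s / p)) ^ (p / s) = N ^ (p / s) * (2 ^ p * M l) := by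
      rw [ENNReal.mul_rpow_of_nonneg _ _ (by positivity), ← ENNReal.rpow_mul,
        div_mul_div_cancel₀ hp0.ne', div_self hs0.ne', ENNReal.rpow_one]
    calc (k (2 ^ l) : ℝ≥0∞) * (N ^ (-p) * (N * (2 ^ p * M l) ^ (s / p)) ^ (p / s))
        = 2 ^ p * (((k (2 ^ l) : ℝ≥0∞) * M l) * (N ^ (-p) * N ^ (p / s))) := by rw [h3]; ring
      _ ≤ 2 ^ p * (N ^ (p * (1 - b)) * (N ^ (-p) * N ^ (p / s))) := by gcongr
      _ = _ := by
          rw [← ENNReal.rpow_add _ _ hN0 hNt, ← ENNReal.rpow_add _ _ hN0 hNt]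
          congr 2
          field_simp; ring
  · rw [ENNReal.tsum_mul_left]
    exact ENNReal.mul_ne_top (ENNReal.rpow_ne_top_of_nonneg hp0.le (by simp))
      (tsum_two_pow_rpow_ne_top hδ)

end

/-! ### Exponentially many coordinates -/

section

theorem eLpNorm_le_dBar {Ω : Type*} {m0 : MeasurableSpace Ω} {μ : Measure Ω} {x : ℕ → ℕ → Ω → ℝ}
    {k : ℕ → ℕ} (hk : Monotone k) {q : ℝ} {n i t : ℕ} (hi : i ∈ Finset.Icc 1 (k n))
    (ht : t ∈ Finset.Icc 1 n) : eLpNorm (x i t) (ENNReal.ofReal q) μ ≤ dBar μ x k q := by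
  refine le_limsup_of_frequently_le (Eventually.frequently ?_)
  filter_upwards [eventually_ge_atTop n] with m hm
  exact (Finset.le_sup (f := fun t => eLpNorm (x i t) (ENNReal.ofReal q) μ)
    (Finset.Icc_subset_Icc_right hm ht)).trans (Finset.le_sup (f := fun i =>
      (Finset.Icc 1 m).sup fun t => eLpNorm (x i t) (ENNReal.ofReal q) μ)
        (Finset.Icc_subset_Icc_right (hk hm) hi))

/-- Finiteness of `γ̊_i(α)` for one nondegenerate coordinate bounds the growth of the moments of all
coordinates. -/
theorem exists_eLpNorm_le_of_gammaRing_lt_top {Ω : Type*} {m0 : MeasurableSpace Ω} {μ : Measure Ω}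
    {x : ℕ → ℕ → Ω → ℝ} {k : ℕ → ℕ} (hk : Monotone k) {ψ : ℕ → ℕ → ℝ≥0} {α : ℝ} (hα : 1 < α)
    (hα2 : α ≤ 2) {j : ℕ} (hψ0 : ∑' m, (ψ j m : ℝ≥0∞) ≠ 0) (hψt : ∑' m, (ψ j m : ℝ≥0∞) ≠ ∞)
    (hγ : gammaRing μ x k ψ α j < ∞) :
    ∃ L : ℝ≥0, ∀ᶠ q : ℝ in atTop, ∀ n : ℕ, ∀ i ∈ Finset.Icc 1 (k n), ∀ t ∈ Finset.Icc 1 n,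
      eLpNorm (x i t) (ENNReal.ofReal q) μ ≤ L * ENNReal.ofReal (q ^ (1 / α - 1 / 2)) := by
  have hα0 : 0 < α := by linarith
  obtain ⟨B, hB, -⟩ := ENNReal.lt_iff_exists_nnreal_btwn.1 hγ
  have h1 := eventually_lt_of_limsup_lt hB
  have h2 : Tendsto (fun q : ℝ => q / α) atTop atTop := tendsto_id.atTop_div_const hα0
  have he : 0 ≤ 1 / α - 1 / 2 := by
    rw [sub_nonneg]; exact one_div_le_one_div_of_le hα0 hα2
  set Ψ := ∑' m, (ψ j m : ℝ≥0∞)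
  refine ⟨(B * Ψ⁻¹).toNNReal, ?_⟩
  rw [ENNReal.coe_toNNReal (ENNReal.mul_ne_top ENNReal.coe_ne_top (ENNReal.inv_ne_top.2 hψ0))]
  filter_upwards [h2.eventually h1, eventually_gt_atTop 0] with q hq hq0 n i hi t ht
  refine (eLpNorm_le_dBar hk hi ht).trans ?_
  rw [mul_div_cancel₀ _ hα0.ne'] at hq
  have hqα : 0 < q / α := by positivity
  have hu : ENNReal.ofReal ((q / α) ^ (1 / 2 - 1 / α)) ≠ 0 := by
    simpa using Real.rpow_pos_of_pos hqα _
  have hinv : (ENNReal.ofReal ((q / α) ^ (1 / 2 - 1 / α)))⁻¹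
      = ENNReal.ofReal ((q / α) ^ (1 / α - 1 / 2)) := by
    rw [← ENNReal.ofReal_inv_of_pos (Real.rpow_pos_of_pos hqα _), ← Real.rpow_neg hqα.le]
    congr 2; ring
  have h3 : dBar μ x k q ≤ B / (ENNReal.ofReal ((q / α) ^ (1 / 2 - 1 / α)) * Ψ) := by
    rw [ENNReal.le_div_iff_mul_le (Or.inl (mul_ne_zero hu hψ0))
      (Or.inl (ENNReal.mul_ne_top ENNReal.ofReal_ne_top hψt))]
    refine le_trans (le_of_eq ?_) hq.le
    ring
  refine h3.trans ?_
  rw [div_eq_mul_inv, ENNReal.mul_inv (Or.inl hu) (Or.inl ENNReal.ofReal_ne_top), hinv,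
    mul_comm (ENNReal.ofReal _), ← mul_assoc]
  gcongr
  exact div_le_self hq0.le hα.le

theorem momentConst_le {q : ℝ} (hq : 2 ≤ q) :
    momentConst q ≤ ENNReal.ofReal (4 * q ^ (1 / 2 : ℝ)) := by
  have hq0 : 0 < q := by linarith
  have h1 : q / (q - 1) ≤ 2 := by rw [div_le_iff₀ (by linarith)]; linarith
  have h4 : (4 : ℝ) ^ (1 / 2 : ℝ) = 2 := by
    rw [← Real.sqrt_eq_rpow, show (4 : ℝ) = 2 ^ 2 by norm_num, Real.sqrt_sq two_pos.le]
  rw [momentConst, min_eq_right hq, ENNReal.ofReal_rpow_of_nonneg (by positivity) (by positivity),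
    ← ENNReal.ofReal_mul (div_nonneg hq0.le (by linarith)), Real.mul_rpow (by norm_num) hq0.le, h4]
  refine ENNReal.ofReal_le_ofReal ?_
  calc q / (q - 1) * (2 * q ^ (1 / 2 : ℝ)) ≤ 2 * (2 * q ^ (1 / 2 : ℝ)) := by gcongr
    _ = _ := by ring

variable {Ω S : Type*} [mS : MeasurableSpace S] {m0 : MeasurableSpace Ω} {μ : Measure Ω}
  {ε ε' : ℕ → ℤ → Ω → S} {g : ℕ → ℕ → (ℕ → S) → ℝ}

/-- Subexponential tail bound: a moment bound of order `q = a N^{α/2}` with a norm of order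
`q^{1/α-1/2}` gives a probability of order `e^{-q}`. -/
theorem measure_le_runMax_le_exp [IsProbabilityMeasure μ] (hε : IsInnovation μ ε ε') {i : ℕ}
    (hi : 1 ≤ i) (hg : ∀ t, 1 ≤ t → Measurable (g i t))
    (hint : ∀ t, 1 ≤ t → Integrable (proc g ε i t) μ)
    (hmean : ∀ t, 1 ≤ t → ∫ ω, proc g ε i t ω ∂μ = 0) {c ψ : ℕ → ℝ≥0} {q : ℝ} (hq : 2 ≤ q)
    (hθ : ∀ t m, 1 ≤ t → theta μ g ε ε' q i t m ≤ c t * ψ m)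
    {Ψ L : ℝ≥0} (hΨ : ∑' m, (ψ m : ℝ≥0∞) ≤ Ψ) {α : ℝ} (hα : 0 < α) {N : ℕ} (hN : N ≠ 0)
    (hc : ∀ t ∈ Finset.Icc 1 N, (c t : ℝ≥0∞) ≤ 2 * (L * ENNReal.ofReal (q ^ (1 / α - 1 / 2))))
    {r a : ℝ} (hr : 0 < r) (ha : 0 < a) (hqa : q = a * (N : ℝ) ^ (α / 2))
    (hra : 16 * L * Ψ / r * a ^ (1 / α) ≤ Real.exp (-1)) :
    μ {ω | r * N ≤ runMax (partialSum (proc g ε i)) N ω} ≤ ENNReal.ofReal (Real.exp (-q)) := by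
  have hq0 : 0 < q := by linarith
  have hNr : (0 : ℝ) < N := by exact_mod_cast Nat.pos_of_ne_zero hN
  set X : ℝ := 2 * (L * q ^ (1 / α - 1 / 2)) with hX
  have hX0 : 0 ≤ X := by positivity
  have hcX : ∀ t ∈ Finset.Icc 1 N, (c t : ℝ≥0∞) ≤ ENNReal.ofReal X := by
    intro t ht
    rw [hX, ENNReal.ofReal_mul two_pos.le, ENNReal.ofReal_mul L.coe_nonneg, ENNReal.ofReal_coe_nnreal,
      ENNReal.ofReal_ofNat]
    exact hc t ht
  have hsum : (∑ t ∈ Finset.Icc 1 N, (c t : ℝ≥0∞) ^ (min q 2)) ^ (1 / min q 2)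
      ≤ ENNReal.ofReal ((N : ℝ) ^ (1 / 2 : ℝ) * X) := by
    rw [min_eq_right hq]
    have h1 : ∑ t ∈ Finset.Icc 1 N, (c t : ℝ≥0∞) ^ (2 : ℝ) ≤ N * ENNReal.ofReal X ^ (2 : ℝ) := by
      refine (Finset.sum_le_card_nsmul _ _ (ENNReal.ofReal X ^ (2 : ℝ)) fun t ht => ?_).trans
        (le_of_eq ?_)
      · exact ENNReal.rpow_le_rpow (hcX t ht) two_pos.le
      · rw [Nat.card_Icc, Nat.add_sub_cancel, nsmul_eq_mul]
    refine (ENNReal.rpow_le_rpow h1 (by positivity)).trans (le_of_eq ?_)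
    rw [ENNReal.mul_rpow_of_nonneg _ _ (by positivity), ← ENNReal.rpow_mul,
      mul_one_div_cancel two_ne_zero, ENNReal.rpow_one,
      ENNReal.ofReal_mul (p := (N : ℝ) ^ (1 / 2 : ℝ)) (by positivity),
      ← ENNReal.ofReal_rpow_of_nonneg hNr.le (by positivity), ENNReal.ofReal_natCast]
  refine (measure_le_runMax_le hε hi hg hint hmean (by linarith) hθ N
    (by positivity : 0 < r * N)).trans ?_
  have hpow : q ^ (1 / 2 : ℝ) * q ^ (1 / α - 1 / 2) = a ^ (1 / α) * (N : ℝ) ^ (1 / 2 : ℝ) := by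
    rw [← Real.rpow_add hq0, add_sub_cancel, hqa, Real.mul_rpow ha.le (by positivity),
      ← Real.rpow_mul hNr.le]
    congr 2; field_simp
  have hNN : (N : ℝ) ^ (1 / 2 : ℝ) * (N : ℝ) ^ (1 / 2 : ℝ) = N := by
    rw [← Real.rpow_add hNr]; norm_num
  have hreal : (r * N / 2)⁻¹ * (4 * q ^ (1 / 2 : ℝ) * ((N : ℝ) ^ (1 / 2 : ℝ) * X) * Ψ)
      ≤ Real.exp (-1) := by
    refine le_trans (le_of_eq ?_) hra
    calc _ = 16 * L * Ψ / r * ((N : ℝ)⁻¹ * (N : ℝ) ^ (1 / 2 : ℝ)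
          * (q ^ (1 / 2 : ℝ) * q ^ (1 / α - 1 / 2))) := by rw [hX]; field_simp; ring
      _ = 16 * L * Ψ / r * ((N : ℝ)⁻¹ * ((N : ℝ) ^ (1 / 2 : ℝ) * (N : ℝ) ^ (1 / 2 : ℝ))
          * a ^ (1 / α)) := by rw [hpow]; ring
      _ = _ := by rw [hNN, inv_mul_cancel₀ hNr.ne', one_mul]
  have hexp : Real.exp (-q) = Real.exp (-1) ^ q := by
    rw [← Real.exp_mul]; congr 1; ring
  rw [hexp, ← ENNReal.ofReal_rpow_of_pos (Real.exp_pos _)]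
  refine ENNReal.rpow_le_rpow (le_trans ?_ (ENNReal.ofReal_le_ofReal hreal)) hq0.le
  rw [ENNReal.ofReal_mul (by positivity), ENNReal.ofReal_mul (by positivity),
    ENNReal.ofReal_mul (by positivity), ENNReal.ofReal_inv_of_pos (by positivity),
    ENNReal.ofReal_coe_nnreal]
  gcongr
  exact momentConst_le hq

/-- Convergence for `log k_n = o(n^(α/2))`, under moments of order `q^(1/α-1/2)`. -/
theorem ae_tendsto_maxMean_of_log [IsProbabilityMeasure μ] (hε : IsInnovation μ ε ε')
    (hg : ∀ i t : ℕ, 1 ≤ i → 1 ≤ t → Measurable (g i t))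
    (hint : ∀ i t : ℕ, 1 ≤ i → 1 ≤ t → Integrable (proc g ε i t) μ)
    (hmean : ∀ i t : ℕ, 1 ≤ i → 1 ≤ t → ∫ ω, proc g ε i t ω ∂μ = 0)
    {k : ℕ → ℕ} (hk : Monotone k) {d : ℝ → ℕ → ℕ → ℝ≥0} {ψ : ℕ → ℕ → ℝ≥0} {Ψ L : ℝ≥0}
    (hΨ : ∀ i, 1 ≤ i → ∑' m, (ψ i m : ℝ≥0∞) ≤ Ψ) {α : ℝ} (hα : 0 < α)
    (hd : ∀ᶠ q : ℝ in atTop, ∀ i t : ℕ, 1 ≤ i → 1 ≤ t →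
      (∀ m : ℕ, theta μ g ε ε' q i t m ≤ d q i t * ψ i m) ∧
      (d q i t : ℝ≥0∞) ≤ 2 * eLpNorm (proc g ε i t) (ENNReal.ofReal q) μ)
    (hL : ∀ᶠ q : ℝ in atTop, ∀ n : ℕ, ∀ i ∈ Finset.Icc 1 (k n), ∀ t ∈ Finset.Icc 1 n,
      eLpNorm (proc g ε i t) (ENNReal.ofReal q) μ ≤ L * ENNReal.ofReal (q ^ (1 / α - 1 / 2)))
    (hlog : (fun n : ℕ => Real.log (k n)) =o[atTop] (fun n : ℕ => (n : ℝ) ^ (α / 2))) :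
    ∀ᵐ ω ∂μ, Tendsto (fun n => maxMean (proc g ε) k n ω) atTop (𝓝 0) := by
  refine ae_tendsto_maxMean hk fun r hr => ?_
  set A : ℝ := 16 * L * Ψ / r with hA
  have hA0 : 0 ≤ A := by positivity
  -- This `a` makes the base of the `q`-th power in the tail bound at most `e⁻¹`.
  set a : ℝ := (Real.exp (-1) / (A + 1)) ^ α with ha_def
  have ha : 0 < a := by positivity
  have haA : A * a ^ (1 / α) ≤ Real.exp (-1) := by
    rw [ha_def, ← Real.rpow_mul (by positivity), mul_one_div_cancel hα.ne', Real.rpow_one,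
      ← mul_div_assoc, div_le_iff₀ (by positivity)]
    nlinarith [Real.exp_pos (-1)]
  have h2 : Tendsto (fun l : ℕ => 2 ^ l) atTop atTop :=
    tendsto_pow_atTop_atTop_of_one_lt (one_lt_two : (1 : ℕ) < 2)
  have hqlim : Tendsto (fun l : ℕ => a * (((2 ^ l : ℕ) : ℝ)) ^ (α / 2)) atTop atTop :=
    ((tendsto_rpow_atTop (by positivity : 0 < α / 2)).comp
      (tendsto_natCast_atTop_atTop.comp h2)).const_mul_atTop ha
  refine tsum_lt_top_of_eventually_le
    (b := fun l : ℕ => ENNReal.ofReal (2 / a) * ((2 ^ l : ℕ) : ℝ≥0∞) ^ (-(α / 2)))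
    (fun l => ENNReal.sum_ne_top.2 fun i _ => measure_ne_top _ _) ?_ ?_
  · filter_upwards [hqlim.eventually hd, hqlim.eventually hL,
      hqlim.eventually (eventually_ge_atTop 2),
      h2.eventually (hlog.bound (by positivity : 0 < a / 2))] with l hdl hLl hq hkl
    set N : ℕ := 2 ^ l with hN
    have hN0 : N ≠ 0 := by positivity
    have hNr : (0 : ℝ) < N := by exact_mod_cast Nat.pos_of_ne_zero hN0
    set q : ℝ := a * (N : ℝ) ^ (α / 2) with hqdef
    have hterm : ∀ i ∈ Finset.Icc 1 (k N),
        μ {ω | r * 2 ^ l ≤ runMax (partialSum (proc g ε i)) N ω}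
          ≤ ENNReal.ofReal (Real.exp (-q)) := by
      intro i hi
      have hi1 := (Finset.mem_Icc.1 hi).1
      have hcast : r * 2 ^ l = r * (N : ℝ) := by rw [hN]; push_cast; rfl
      rw [hcast]
      refine measure_le_runMax_le_exp hε hi1 (fun t => hg i t hi1) (fun t => hint i t hi1)
        (fun t => hmean i t hi1) hq (fun t m ht => (hdl i t hi1 ht).1 m) (hΨ i hi1) hα hN0 ?_ hr ha
        hqdef haA
      intro t ht
      refine (hdl i t hi1 (Finset.mem_Icc.1 ht).1).2.trans ?_
      gcongr
      exact hLl N i hi t ht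
    refine (Finset.sum_le_card_nsmul _ _ _ hterm).trans ?_
    rw [Nat.card_Icc, Nat.add_sub_cancel, nsmul_eq_mul]
    rcases Nat.eq_zero_or_pos (k N) with h0 | h0
    · simp [h0]
    have hkr : (0 : ℝ) < k N := by exact_mod_cast h0
    have hkexp : (k N : ℝ) ≤ Real.exp (q / 2) := by
      rw [← Real.exp_log hkr]
      refine Real.exp_le_exp.2 ?_
      rw [Real.norm_eq_abs, Real.norm_eq_abs, abs_of_nonneg (by positivity : 0 ≤ (N : ℝ) ^ (α / 2))]
        at hkl
      calc Real.log (k N) ≤ a / 2 * (N : ℝ) ^ (α / 2) := (le_abs_self _).trans hkl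
        _ = q / 2 := by rw [hqdef]; ring
    have hfin : (k N : ℝ) * Real.exp (-q) ≤ 2 / a * (N : ℝ) ^ (-(α / 2)) := by
      calc (k N : ℝ) * Real.exp (-q) ≤ Real.exp (q / 2) * Real.exp (-q) := by gcongr
        _ = (Real.exp (q / 2))⁻¹ := by rw [← Real.exp_add, ← Real.exp_neg]; congr 1; ring
        _ ≤ (q / 2)⁻¹ := by
            have : 0 < q / 2 := by linarith
            gcongr
            linarith [Real.add_one_le_exp (q / 2)]
        _ = _ := by rw [hqdef, Real.rpow_neg hNr.le]; field_simp
    calc (k N : ℝ≥0∞) * ENNReal.ofReal (Real.exp (-q))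
        = ENNReal.ofReal ((k N : ℝ) * Real.exp (-q)) := by
          rw [ENNReal.ofReal_mul hkr.le, ENNReal.ofReal_natCast]
      _ ≤ ENNReal.ofReal (2 / a * (N : ℝ) ^ (-(α / 2))) := ENNReal.ofReal_le_ofReal hfin
      _ = _ := by
          rw [ENNReal.ofReal_mul (by positivity), ← ENNReal.ofReal_rpow_of_pos hNr,
            ENNReal.ofReal_natCast]
  · rw [ENNReal.tsum_mul_left]
    exact ENNReal.mul_ne_top ENNReal.ofReal_ne_top (tsum_two_pow_rpow_ne_top (by positivity))

end

end MaxLLN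


theorem mainTheorem2 {Ω S : Type*} [MeasurableSpace Ω] [MeasurableSpace S]
    (μ : Measure Ω) [IsProbabilityMeasure μ]
    (ε ε' : ℕ → ℤ → Ω → S) (hε : MaxLLN.IsInnovation μ ε ε')
    (g : ℕ → ℕ → (ℕ → S) → ℝ) (hg : ∀ i t : ℕ, 1 ≤ i → 1 ≤ t → Measurable (g i t))
    (x : ℕ → ℕ → Ω → ℝ) (hx : x = MaxLLN.proc g ε)
    (hint : ∀ i t : ℕ, 1 ≤ i → 1 ≤ t → Integrable (x i t) μ)
    (hmean : ∀ i t : ℕ, 1 ≤ i → 1 ≤ t → ∫ ω, x i t ω ∂μ = 0)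
    (k : ℕ → ℕ) (hk : Monotone k)
    (p : ℝ) (hp : 1 < p) (hpd : MaxLLN.IsPhysDep μ g ε ε' p)
    (d : ℝ → ℕ → ℕ → ℝ≥0) (ψ : ℕ → ℕ → ℝ≥0)
    (hθ : ∀ i t m : ℕ, 1 ≤ i → 1 ≤ t → MaxLLN.theta μ g ε ε' p i t m ≤ d p i t * ψ i m)
    (lam : ℝ) (hlam : 1 ≤ lam)
    (hψ : ∃ ι > (0 : ℝ), ∃ C : ℝ, ∀ i m : ℕ, 1 ≤ i →
      (ψ i m : ℝ) ≤ C * ((max m 1 : ℕ) : ℝ) ^ (-lam - ι)) :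
    -- part (a)
    (∀ b : ℝ, 1 / min p 2 < b → b < 1 →
      ((⨆ n : ℕ, MaxLLN.weightedSum (d p) k p b n) < ∞ ∨
        ((∀ n, MaxLLN.weightedSum (d p) k p b n < ∞) ∧
          ∀ i t : ℕ, 1 ≤ i → 1 ≤ t →
            (d p i t : ℝ≥0∞) ≤ 2 * eLpNorm (x i t) (ENNReal.ofReal p) μ)) →
      Tendsto (fun n : ℕ =>
        (k n : ℝ≥0∞) * MaxLLN.maxMoment μ x k p n / (n : ℝ≥0∞) ^ (p * (1 - b))) atTop (𝓝 0) →
      ∀ᵐ ω ∂μ, Tendsto (fun n => MaxLLN.maxMean x k n ω) atTop (𝓝 0)) ∧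
    -- part (b)
    (∀ α : ℝ, 1 < α → α ≤ 2 →
      (∀ᶠ q : ℝ in atTop, ∀ i t : ℕ, 1 ≤ i → 1 ≤ t →
        (∀ m : ℕ, MaxLLN.theta μ g ε ε' q i t m ≤ d q i t * ψ i m) ∧
        (d q i t : ℝ≥0∞) ≤ 2 * eLpNorm (x i t) (ENNReal.ofReal q) μ) →
      (⨆ i : ℕ, ⨆ _ : 1 ≤ i, MaxLLN.gammaRing μ x k ψ α i) < ∞ →
      ∀ ι : ℝ, 0 < ι →
      (fun n : ℕ => Real.log (k n)) =o[atTop] (fun n : ℕ => (n : ℝ) ^ (α / 2 - ι)) →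
      ∀ᵐ ω ∂μ, Tendsto (fun n => MaxLLN.maxMean x k n ω) atTop (𝓝 0)) := by
  subst hx
  obtain ⟨Ψ, hΨt, hΨ⟩ := MaxLLN.exists_tsum_le hlam hψ
  refine ⟨fun b hb hb1 hd hlim => ?_, fun α hα hα2 hd hγ ι hι hlog => ?_⟩
  · rcases hd with hd | ⟨-, hd⟩
    · have hb0 : 0 < b := lt_trans (one_div_pos.2 (lt_min (by linarith) two_pos)) hb
      exact MaxLLN.ae_tendsto_maxMean_of_weightedSum hε hg hint hmean hk hp hθ hΨt hΨ hb0 hd hlim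
    · exact MaxLLN.ae_tendsto_maxMean_of_le_eLpNorm hε hg hint hmean hk hp hθ hΨt hΨ hb hd hlim
  -- If all `ψ` vanish, the hypothesis on `γ̊` carries no information on the moments, but the tail
  -- bound is zero.
  · by_cases hz : ∀ i, 1 ≤ i → ∑' m, (ψ i m : ℝ≥0∞) = 0
    · refine MaxLLN.ae_tendsto_maxMean hk fun r hr => ne_of_eq_of_ne ?_ ENNReal.zero_ne_top
      refine ENNReal.tsum_eq_zero.2 fun l => Finset.sum_eq_zero fun i hi => ?_
      have hi1 := (Finset.mem_Icc.1 hi).1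
      refine le_antisymm ((MaxLLN.measure_le_runMax_le hε hi1 (fun t => hg i t hi1)
        (fun t => hint i t hi1) (fun t => hmean i t hi1) hp (fun t m => hθ i t m hi1) (2 ^ l)
        (by positivity)).trans (le_of_eq ?_)) zero_le
      rw [hz i hi1, mul_zero, mul_zero, ENNReal.zero_rpow_of_pos (by linarith)]
    · push Not at hz
      obtain ⟨j, hj, hj0⟩ := hz
      obtain ⟨L, hL⟩ := MaxLLN.exists_eLpNorm_le_of_gammaRing_lt_top hk hα hα2 hj0
        (ne_top_of_le_ne_top hΨt (hΨ j hj)) ((le_iSup₂ j hj).trans_lt hγ)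
      lift Ψ to ℝ≥0 using hΨt
      refine MaxLLN.ae_tendsto_maxMean_of_log hε hg hint hmean hk hΨ (by linarith) hd hL
        (hlog.trans_isBigO ?_)
      refine IsBigO.of_bound 1 ?_
      filter_upwards [eventually_ge_atTop 1] with n hn
      have hn1 : (1 : ℝ) ≤ n := by exact_mod_cast hn
      rw [Real.norm_of_nonneg (by positivity), Real.norm_of_nonneg (by positivity), one_mul]
      exact Real.rpow_le_rpow_of_exponent_le hn1 (by linarith)
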